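/- Let $t>0$ and let $\Phi(z,s)\in\mathbb R^d$ be a vector field which is continuous on $\mathbb R^d\times[0,t]$ and differentiable in $z$, with Jacobian $D\Phi(z,s)$ continuous on $\mathbb R^d\times[0,t]$. Let $x\in\mathbb R^d$, and suppose that for all $z$ near $x$ the solution $S_s(z)$ of $\frac{d}{ds}z(s)=\Phi(z(s),s)$, $z(0)=z$, exists on $[0,t]$. Let $L(x,s)=DS_s(x)$ be the tangent map. Let $\xi$ be an $\mathbb R^d$-valued white noise, $\langle\xi(s)\rangle=0$, $\langle\xi(s)\xi(u)^T\rangle=I\,\delta(s-u)$; it is given through its primitive $W(s)=\int_0^s\xi(r)\,dr$, a square integrable process with almost surely continuous paths, $\langle W(s)\rangle=0$ and $\langle W(s)W(u)^T\rangle=\min(s,u)\,I$ for $s,u\ge 0$ (for instance the Wiener process). Equations driven by $\xi$ are understood in integrated form, and integrals of continuous matrix functions against a noise are mean-square limits of Riemann–Stieltjes sums with respect to the primitive of the noise. For $\varepsilon$ near $0$ let $y_\varepsilon$ be the solution on $[0,2t]$, with $y_\varepsilon(0)=x$, of the forward flow followed by the backward flow with additive noise, $$\dot y_\varepsilon(s)=\Phi(y_\varepsilon(s),s)+\varepsilon\xi(s)\quad(0\le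 s\le t),\qquad \dot y_\varepsilon(s)=-\Phi(y_\varepsilon(s),2t-s)+\varepsilon\xi(s)\quad(t\le s\le 2t),$$ and let the linear response be $\Xi(s)=\lim_{\varepsilon\to0}\bigl(y_\varepsilon(s)-y_0(s)\bigr)/\varepsilon$, $0\le s\le 2t$. Then: (0) For $s\in[0,t]$ the map $S_s$ is differentiable at $x$, and $L(x,s)$ is invertible and continuous in $s$. (1) Almost surely $y_\varepsilon$ exists on $[0,2t]$ for all sufficiently small $|\varepsilon|$ and the limit $\Xi(s)$ exists for all $s\in[0,2t]$. A process is the linear response if and only if it almost surely is continuous on $[0,2t]$ and solves there $\dot\Xi(s)=D\Phi(S_s(x),s)\,\Xi(s)+\xi(s)$ for $s\le t$, $\dot\Xi(s)=-D\Phi(S_{2t-s}(x),2t-s)\,\Xi(s)+\xi(s)$ for $s\ge t$, with $\Xi(0)=0$. At time $2t$, almost surely, $$\Xi(2t)=\int_0^tL^{-1}(x,s)\bigl(\xi(s)+\xi(2t-s)\bigr)\,ds,$$ where $\xi(s)+\xi(2t-s)$ has the primitive $W(s)+W(2t)-W(2t-s)$. Moreover $\langle\Xi(2t)\rangle=0$,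 and $$\Sigma^2_{BF}(x,t):=\tfrac12\bigl\langle\Xi(2t)\,\Xi(2t)^T\bigr\rangle=\int_0^t\bigl(L^T(x,s)L(x,s)\bigr)^{-1}ds .$$ (2) If the noise acts only during the forward evolution (that is, $\xi(s)$ is replaced by $0$ for $s>t$), then again $y_\varepsilon$ exists on $[0,2t]$ for small $|\varepsilon|$, $\Xi$ exists and is characterized by the corresponding linear equation, and $\Xi(2t)=\int_0^tL^{-1}(x,s)\,\xi(s)\,ds$, $\langle\Xi(2t)\rangle=0$, and, without the factor $\tfrac12$, $$\bigl\langle\Xi(2t)\,\Xi(2t)^T\bigr\rangle=\int_0^t\bigl(L^T(x,s)L(x,s)\bigr)^{-1}ds .$$ -/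

import Mathlib

open MeasureTheory ProbabilityTheory Filter Set
open scoped Topology ENNReal NNReal

noncomputable section

/-- The phase space `ℝ^d` with its Euclidean norm. -/
abbrev PhaseSpace (d : ℕ) : Type := EuclideanSpace ℝ (Fin d)

/-- The time-dependent vector field `Φ` (written `Φ s z` for the value at the point `z` and the
time `s`) is continuous on `[0,t] × ℝ^d`, differentiable in the space variable, and its space
Jacobian is continuous on `[0,t] × ℝ^d`. -/
structure IsC1Field {d : ℕ} (Φ : ℝ → PhaseSpace d → PhaseSpace d) (t : ℝ) : Prop where
  continuousOn : ContinuousOn (fun p : ℝ × PhaseSpace d => Φ p.1 p.2) (Icc 0 t ×ˢ univ)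
  differentiable : ∀ s ∈ Icc (0 : ℝ) t, Differentiable ℝ (Φ s)
  continuousOn_fderiv :
    ContinuousOn (fun p : ℝ × PhaseSpace d => fderiv ℝ (Φ p.1) p.2) (Icc 0 t ×ˢ univ)

/-- `S s z` is, for all initial points `z` near `x` and all times `s ∈ [0,t]`, the solution at
time `s` of `dz/ds = Φ(z,s)` which starts from `z` at time `0`. -/
def IsForwardFlow {d : ℕ} (Φ : ℝ → PhaseSpace d → PhaseSpace d) (t : ℝ) (x : PhaseSpace d)
    (S : ℝ → PhaseSpace d → PhaseSpace d) : Prop :=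
  ∀ᶠ z in 𝓝 x, S 0 z = z ∧ IsIntegralCurveOn (fun s => S s z) Φ (Icc 0 t)

/-- The tangent map `L(x,s) = D S_s(x)`, with entries `L_ij = ∂ (S_s(x))_i / ∂ x_j`. -/
def tangentMatrix {d : ℕ} (S : ℝ → PhaseSpace d → PhaseSpace d) (x : PhaseSpace d) (s : ℝ) :
    Matrix (Fin d) (Fin d) ℝ :=
  Matrix.of fun i j => fderiv ℝ (S s) x (EuclideanSpace.single j 1) i

/-- White noise `ξ` on `[0,∞)` with values in `ℝ^d`, given through its primitive
`W(s) = ∫₀ˢ ξ(r) dr`: a square integrable process with almost surely continuous paths such that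
`⟨W(s)⟩ = 0` and `⟨W(s) W(u)ᵀ⟩ = min(s,u) I`, which is the integrated form of `⟨ξ(s)⟩ = 0`,
`⟨ξ(s) ξ(u)ᵀ⟩ = I δ(s-u)`. -/
structure IsIntegratedWhiteNoise {d : ℕ} {Ω : Type*} [MeasurableSpace Ω]
    (W : ℝ → Ω → PhaseSpace d) (P : Measure Ω) : Prop where
  memLp_two : ∀ s, 0 ≤ s → MemLp (W s) 2 P
  mean_eq_zero : ∀ s, 0 ≤ s → ∫ ω, W s ω ∂P = 0
  correlation : ∀ s u, 0 ≤ s → 0 ≤ u → ∀ i j : Fin d,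
    ∫ ω, W s ω i * W u ω j ∂P = if i = j then min s u else 0
  continuous_paths : ∀ᵐ ω ∂P, ContinuousOn (fun s => W s ω) (Ici 0)

/-- A vector of `d` independent Brownian motions, that is, Wiener noise in `ℝ^d`, is the
primitive of a white noise. -/
theorem isIntegratedWhiteNoise_of_brownian {d : ℕ} {Ω : Type*} [MeasurableSpace Ω]
    {P : Measure Ω} [IsProbabilityMeasure P] (B : Fin d → ℝ≥0 → Ω → ℝ)
    (hB : ∀ i, IsBrownianReal (B i) P)
    (hind : iIndepFun (fun i ω s => B i s ω) P) :
    IsIntegratedWhiteNoise (fun s ω => WithLp.toLp 2 fun i => B i s.toNNReal ω) P := by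
  have hm : ∀ i s, MemLp (B i s) 2 P := fun i s =>
    ((hB i).hasLaw_eval s).hasGaussianLaw.memLp_two
  have h2 : ∀ s : ℝ≥0, MemLp (fun ω => WithLp.toLp 2 fun i => B i s ω : Ω → PhaseSpace d) 2 P :=
    fun s => MemLp.of_eval_piLp fun i => hm i s
  refine ⟨fun s _ => h2 _, fun s _ => ?_, fun s u hs hu i j => ?_, ?_⟩
  · ext i
    rw [eval_integral_piLp (fun i => (hm i _).integrable (by norm_num))]
    simpa using (hB i).integral_eval s.toNNReal
  · have hc : cov[B i s.toNNReal, B j u.toNNReal; P] =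
        ∫ ω, B i s.toNNReal ω * B j u.toNNReal ω ∂P := by
      rw [covariance_eq_sub (hm _ _) (hm _ _), (hB i).integral_eval, (hB j).integral_eval]
      simp
    change ∫ ω, B i s.toNNReal ω * B j u.toNNReal ω ∂P = _
    rw [← hc]
    split_ifs with h
    · subst h
      rw [(hB i).covariance_eval]
      simp [hs, hu]
    · exact ((hind.indepFun h).comp (measurable_pi_apply s.toNNReal)
        (measurable_pi_apply u.toNNReal)).covariance_eq_zero (hm _ _) (hm _ _)
  · filter_upwards [ae_all_iff.2 fun i => (hB i).cont] with ω hω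
    have : Continuous fun s : ℝ => (WithLp.toLp 2 fun i => B i s.toNNReal ω : PhaseSpace d) :=
      (PiLp.continuous_toLp 2 _).comp
        (continuous_pi fun i => (hω i).comp continuous_real_toNNReal)
    exact this.continuousOn

/-- The vector field of the forward evolution followed by the backward evolution: `Φ(z,s)` for
`0 ≤ s < t` and `-Φ(z,2t-s)` for `t ≤ s ≤ 2t`. -/
def bfField {d : ℕ} (Φ : ℝ → PhaseSpace d → PhaseSpace d) (t s : ℝ) (z : PhaseSpace d) :
    PhaseSpace d :=
  if s < t then Φ s z else -Φ (2 * t - s) z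

/-- The path `y` solves, on `[0,2t]` and with `y(0) = x`, the equation
`dy/ds = bfField(y,s) + ε ξ(s)`, in integrated form; `N` is the path of the primitive of `ξ`. -/
def IsBFSolution {d : ℕ} (Φ : ℝ → PhaseSpace d → PhaseSpace d) (t : ℝ) (x : PhaseSpace d)
    (N : ℝ → PhaseSpace d) (ε : ℝ) (y : ℝ → PhaseSpace d) : Prop :=
  ContinuousOn y (Icc 0 (2 * t)) ∧
    ∀ τ ∈ Icc 0 (2 * t), y τ = x + (∫ s in (0 : ℝ)..τ, bfField Φ t s (y s)) + ε • N τ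

/-- The process `Ξ` is the linear response of the forward-backward evolution to the noise with
primitive `N`: almost surely the noisy equation is solvable on `[0,2t]` for all small amplitudes
`ε`, and `Ξ(τ) = lim_{ε → 0} (y_ε(τ) - y_0(τ)) / ε` for all `τ ∈ [0,2t]`, where `y_ε` solves the
equation with amplitude `ε` (so that `y_0` is the orbit without noise). -/
def IsLinearResponse {d : ℕ} {Ω : Type*} [MeasurableSpace Ω] (P : Measure Ω)
    (Φ : ℝ → PhaseSpace d → PhaseSpace d) (t : ℝ) (x : PhaseSpace d)
    (N Ξ : ℝ → Ω → PhaseSpace d) : Prop :=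
  ∀ᵐ ω ∂P,
    (∀ᶠ ε in 𝓝 (0 : ℝ), ∃ y, IsBFSolution Φ t x (fun τ => N τ ω) ε y) ∧
    ∀ y : ℝ → ℝ → PhaseSpace d,
      (∀ᶠ ε in 𝓝 (0 : ℝ), IsBFSolution Φ t x (fun τ => N τ ω) ε (y ε)) →
      ∀ τ ∈ Icc 0 (2 * t),
        Tendsto (fun ε : ℝ => ε⁻¹ • (y ε τ - y 0 τ)) (𝓝[≠] 0) (𝓝 (Ξ τ ω))

/-- The process `Ξ` solves almost surely, on `[0,2t]` and with `Ξ(0) = 0`, the linear equation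
`dΞ/ds = DΦ(S_s(x),s) Ξ + ξ(s)` for `s < t`, `dΞ/ds = -DΦ(S_{2t-s}(x),2t-s) Ξ + ξ(s)` for
`s ≥ t`, in integrated form; `N` is the primitive of `ξ`. -/
def SolvesLinearEquation {d : ℕ} {Ω : Type*} [MeasurableSpace Ω] (P : Measure Ω)
    (Φ : ℝ → PhaseSpace d → PhaseSpace d) (t : ℝ) (x : PhaseSpace d)
    (S : ℝ → PhaseSpace d → PhaseSpace d) (N Ξ : ℝ → Ω → PhaseSpace d) : Prop :=
  ∀ᵐ ω ∂P, ContinuousOn (fun τ => Ξ τ ω) (Icc 0 (2 * t)) ∧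
    ∀ τ ∈ Icc 0 (2 * t),
      Ξ τ ω = (∫ s in (0 : ℝ)..τ,
        if s < t then fderiv ℝ (Φ s) (S s x) (Ξ s ω)
        else -fderiv ℝ (Φ (2 * t - s)) (S (2 * t - s) x) (Ξ s ω)) + N τ ω

/-- `X = ∫₀ᵗ G(s) dV(s)` in mean square: the Riemann-Stieltjes sums
`∑ G(c_k) (V(s_{k+1}) - V(s_k))` converge to `X` in `L²(P)` as the mesh of the partition
`0 = s_0 ≤ ⋯ ≤ s_n = t` tends to `0`, for all choices of the tags `c_k ∈ [s_k, s_{k+1}]`.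
If `V` is a primitive of the noise `η` this is `∫₀ᵗ G(s) η(s) ds`. -/
def IsMeanSquareIntegral {d : ℕ} {Ω : Type*} [MeasurableSpace Ω] (P : Measure Ω) (t : ℝ)
    (G : ℝ → Matrix (Fin d) (Fin d) ℝ) (V : ℝ → Ω → PhaseSpace d) (X : Ω → PhaseSpace d) :
    Prop :=
  MemLp X 2 P ∧
    ∀ δ : ℝ≥0∞, 0 < δ → ∃ η : ℝ, 0 < η ∧ ∀ (n : ℕ) (s c : ℕ → ℝ),
      s 0 = 0 → s n = t →
      (∀ k < n, s k ≤ c k ∧ c k ≤ s (k + 1) ∧ s (k + 1) - s k < η) →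
      eLpNorm (fun ω => (∑ k ∈ Finset.range n,
        Matrix.toEuclideanLin (G (c k)) (V (s (k + 1)) ω - V (s k) ω)) - X ω) 2 P < δ

/-- The matrix `⟨X Xᵀ⟩` of a random vector. -/
def meanOuter {d : ℕ} {Ω : Type*} [MeasurableSpace Ω] (P : Measure Ω) (X : Ω → PhaseSpace d) :
    Matrix (Fin d) (Fin d) ℝ :=
  Matrix.of fun i j => ∫ ω, X ω i * X ω j ∂P

/-- The matrix `∫₀ᵗ (Lᵀ(x,s) L(x,s))⁻¹ ds`. -/
def sigmaBF {d : ℕ} (S : ℝ → PhaseSpace d → PhaseSpace d) (x : PhaseSpace d) (t : ℝ) :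
    Matrix (Fin d) (Fin d) ℝ :=
  Matrix.of fun i j =>
    ∫ s in (0 : ℝ)..t, ((tangentMatrix S x s).transpose * tangentMatrix S x s)⁻¹ i j

/-- The primitive `s ↦ ∫₀ˢ (ξ(r) + ξ(2t-r)) dr = W(s) + W(2t) - W(2t-s)` of the noise
`ξ(s) + ξ(2t-s)`, where `W` is the primitive of `ξ`. -/
def foldedNoise {d : ℕ} {Ω : Type*} (t : ℝ) (W : ℝ → Ω → PhaseSpace d) :
    ℝ → Ω → PhaseSpace d :=
  fun s ω => W s ω + (W (2 * t) ω - W (2 * t - s) ω)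

/-- The primitive `τ ↦ W(min(τ,t))` of the noise which equals `ξ` on `[0,t]` and vanishes
afterwards. -/
def forwardNoise {d : ℕ} {Ω : Type*} (t : ℝ) (W : ℝ → Ω → PhaseSpace d) :
    ℝ → Ω → PhaseSpace d :=
  fun τ ω => W (min τ t) ω

end

/-!
The equation of the forward-backward evolution on `[0,2t]` is a Volterra equation
`u - J (Ψ ∘ u) = g` in the Banach space of continuous paths. Here `Ψ` is the field `Φ` taken at the
folded time `min(s, 2t-s)`, `J` integrates a path with the sign `+1` before and `-1` after the
reversal time, and the forcing `g = x + ε W` contains the initial value and the noise. Only the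
sign jumps at time `t`; the superposition operator `u ↦ Ψ ∘ u` is strictly differentiable on paths
(`hasStrictFDerivAt_superposition`).

The linear Volterra operator `1 - J DΨ` is invertible because the norms of the iterates of `J DΨ`
decay like `Cⁿ/n!` (`isUnit_one_sub_weightedPrimitive`), and the same iteration shows that the
nonlinear map is injective (`volterraMap_injective`). The inverse function theorem at the orbit
without noise, which runs along `S_s(x)` and back (`exists_retraced_orbit`), then gives at once the
solvability for small `ε`, the linear response as the solution `R W` of the linearized equation, and
the tangent map as `L(x,s) v = (R v)(s)` for constant forcings `v` (`exists_responseOperator`).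

The inverse `M = L⁻¹` solves the adjoint equation `M' = -M DΦ`. The difference
`p(s) = Ξ(s) - Ξ(2t-s)` starts from `-Ξ(2t)`, vanishes at `s = t`, and solves `p' = DΦ p` with the
folded noise `V` as forcing. Hence `(M (p - V))' = -M' V` and `Ξ(2t) = M(t) V(t) - ∫₀ᵗ M' V ds`
(`exists_response_formula`).

It remains to identify this pathwise expression with the mean-square integral `∫₀ᵗ M dV`. By
summation by parts the difference to a Riemann-Stieltjes sum is an integral of `M'` against
increments of `V` over the intervals of the partition, whose `L²` norm is of the order of the square
root of the mesh (`IsNoisePrimitive.isMeanSquareIntegral`). No joint measurability is needed: paths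
are continuous, so integrals in time are limits of Riemann sums. The moments follow from those of
the sums (`IsMeanSquareIntegral.moments`); the folded noise has the covariance `2 min(s,u) I`, which
accounts for the factor `1/2`.
-/

noncomputable section

/-! ### Volterra operators on spaces of continuous paths -/

section Volterra

variable {E : Type*} [NormedAddCommGroup E] [NormedSpace ℝ E] {T : ℝ}

/-- A measurable weight with values in `[-1,1]`, such as the sign which distinguishes the forward
from the backward evolution. -/
structure IsWeight (c : ℝ → ℝ) : Prop where
  measurable : Measurable c
  norm_le_one : ∀ s, ‖c s‖ ≤ 1

theorem IsWeight.intervalIntegrable_smul {c : ℝ → ℝ} (hc : IsWeight c) {f : ℝ → E} {a b : ℝ}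
    (hf : ContinuousOn f (uIcc a b)) :
    IntervalIntegrable (fun s => c s • f s) volume a b := by
  rw [intervalIntegrable_iff]
  have h := hf.intervalIntegrable (μ := volume)
  rw [intervalIntegrable_iff] at h
  exact h.bdd_smul 1 hc.measurable.aestronglyMeasurable
    (ae_of_all _ hc.norm_le_one)

theorem IsWeight.norm_integral_le {c : ℝ → ℝ} (hc : IsWeight c) {f : ℝ → E} {g : ℝ → ℝ} {a b : ℝ}
    (hab : a ≤ b) (hfg : ∀ s ∈ Ioc a b, ‖f s‖ ≤ g s) (hg : IntervalIntegrable g volume a b) :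
    ‖∫ s in a..b, c s • f s‖ ≤ ∫ s in a..b, g s := by
  refine intervalIntegral.norm_integral_le_of_norm_le hab (ae_of_all _ fun s hs => ?_) hg
  rw [norm_smul]
  exact (mul_le_of_le_one_left (norm_nonneg _) (hc.norm_le_one s)).trans (hfg s hs)

theorem continuous_integral_weight {c : ℝ → ℝ} (hc : IsWeight c) (hT : 0 ≤ T)
    (h : C(Icc (0 : ℝ) T, E)) :
    Continuous fun τ : ℝ => ∫ s in (0 : ℝ)..τ, c s • IccExtend hT h s :=
  intervalIntegral.continuous_primitive
    (fun _ _ => hc.intervalIntegrable_smul h.continuous.Icc_extend'.continuousOn) 0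

/-- The operator which maps a path `h` on `[0,T]` to the path `τ ↦ ∫₀^τ c(s) h(s) ds`. -/
def weightedPrimitive {c : ℝ → ℝ} (hc : IsWeight c) (hT : 0 ≤ T) :
    C(Icc (0 : ℝ) T, E) →L[ℝ] C(Icc (0 : ℝ) T, E) :=
  LinearMap.mkContinuous
    { toFun := fun h => ⟨fun τ => ∫ s in (0 : ℝ)..τ, c s • IccExtend hT h s,
        (continuous_integral_weight hc hT h).comp continuous_subtype_val⟩
      map_add' := fun h k => by
        ext τ
        simp only [ContinuousMap.coe_mk, ContinuousMap.add_apply]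
        rw [← intervalIntegral.integral_add
          (hc.intervalIntegrable_smul h.continuous.Icc_extend'.continuousOn)
          (hc.intervalIntegrable_smul k.continuous.Icc_extend'.continuousOn)]
        simp [IccExtend]
      map_smul' := fun r h => by
        ext τ
        simp only [ContinuousMap.coe_mk, ContinuousMap.smul_apply, RingHom.id_apply]
        rw [← intervalIntegral.integral_smul]
        simp [IccExtend, smul_comm r] } T
    (fun h => by
      refine (ContinuousMap.norm_le _ (by positivity)).2 fun τ => ?_
      refine (hc.norm_integral_le (g := fun _ => ‖h‖) τ.2.1
        (fun s _ => h.norm_coe_le_norm _) intervalIntegrable_const).trans ?_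
      simp only [intervalIntegral.integral_const, sub_zero, smul_eq_mul]
      exact mul_le_mul_of_nonneg_right τ.2.2 (norm_nonneg _))

theorem weightedPrimitive_apply {c : ℝ → ℝ} (hc : IsWeight c) (hT : 0 ≤ T)
    (h : C(Icc (0 : ℝ) T, E)) (τ : Icc (0 : ℝ) T) :
    weightedPrimitive hc hT h τ = ∫ s in (0 : ℝ)..τ, c s • IccExtend hT h s := rfl

/-- One step of the iteration which gains the factorials of the exponential series. -/
theorem norm_weightedPrimitive_le {c : ℝ → ℝ} (hc : IsWeight c) (hT : 0 ≤ T)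
    (h : C(Icc (0 : ℝ) T, E)) {M C : ℝ} {n : ℕ}
    (hh : ∀ s : Icc (0 : ℝ) T, ‖h s‖ ≤ M * (C * (M * s) ^ n / n.factorial))
    (τ : Icc (0 : ℝ) T) :
    ‖weightedPrimitive hc hT h τ‖ ≤ C * (M * τ) ^ (n + 1) / (n + 1).factorial := by
  rw [weightedPrimitive_apply]
  refine (hc.norm_integral_le (g := fun s => M * (C * (M * s) ^ n / n.factorial)) τ.2.1
    (fun s hs => ?_) (Continuous.intervalIntegrable (by fun_prop) _ _)).trans_eq ?_
  · have hs' : s ∈ Icc 0 T := ⟨hs.1.le, hs.2.trans τ.2.2⟩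
    rw [IccExtend_of_mem hT _ hs']
    exact hh ⟨s, hs'⟩
  · have : (fun s : ℝ => M * (C * (M * s) ^ n / n.factorial)) =
        fun s : ℝ => (C * M ^ (n + 1) / n.factorial) * s ^ n := by
      ext s; ring
    rw [this, intervalIntegral.integral_const_mul, integral_pow, Nat.factorial_succ]
    have : (n.factorial : ℝ) ≠ 0 := by positivity
    push_cast
    field_simp
    rw [zero_pow n.succ_ne_zero, sub_zero, mul_pow, mul_assoc]

/-- Pointwise application of a path of linear maps to a path of vectors. -/
def pathApply (B : C(Icc (0 : ℝ) T, E →L[ℝ] E)) : C(Icc (0 : ℝ) T, E) →L[ℝ] C(Icc (0 : ℝ) T, E) :=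
  LinearMap.mkContinuous
    { toFun := fun v => ⟨fun s => B s (v s), by fun_prop⟩
      map_add' := fun v w => by ext s; simp
      map_smul' := fun r v => by ext s; simp } ‖B‖
    (fun v => (ContinuousMap.norm_le _ (by positivity)).2 fun s =>
      (B s).le_of_opNorm_le_of_le (B.norm_coe_le_norm s) (v.norm_coe_le_norm s))

@[simp] theorem pathApply_apply (B : C(Icc (0 : ℝ) T, E →L[ℝ] E)) (v : C(Icc (0 : ℝ) T, E))
    (s : Icc (0 : ℝ) T) : pathApply B v s = B s (v s) := rfl

/-- The linear Volterra equation `v(τ) = g(τ) + ∫₀^τ c(s) B(s) v(s) ds` is uniquely solvable. -/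
theorem isUnit_one_sub_weightedPrimitive [CompleteSpace E] {c : ℝ → ℝ} (hc : IsWeight c)
    (hT : 0 ≤ T) (B : C(Icc (0 : ℝ) T, E →L[ℝ] E)) :
    IsUnit (1 - weightedPrimitive hc hT ∘L pathApply B) := by
  set K := weightedPrimitive hc hT ∘L pathApply B with hK
  have hpow : ∀ (n : ℕ) (v : C(Icc (0 : ℝ) T, E)) (τ : Icc (0 : ℝ) T),
      ‖(K ^ n) v τ‖ ≤ ‖v‖ * (‖B‖ * τ) ^ n / n.factorial := by
    intro n v
    induction n with
    | zero => intro τ; simpa using v.norm_coe_le_norm τ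
    | succ n ih =>
      intro τ
      rw [pow_succ', mul_apply_eq_comp]
      refine norm_weightedPrimitive_le hc hT _ (fun s => ?_) τ
      exact (B s).le_of_opNorm_le_of_le (B.norm_coe_le_norm s) (ih s)
  have hnorm : ∀ n : ℕ, ‖K ^ n‖ ≤ (‖B‖ * T) ^ n / n.factorial := fun n => by
    refine ContinuousLinearMap.opNorm_le_bound _ (by positivity) fun v => ?_
    refine (ContinuousMap.norm_le _ (by positivity)).2 fun τ => (hpow n v τ).trans ?_
    rw [div_mul_eq_mul_div, mul_comm]
    have := τ.2.1
    gcongr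
    exact τ.2.2
  obtain ⟨n, hn⟩ := ((FloorSemiring.tendsto_pow_div_factorial_atTop (‖B‖ * T)).eventually
    (gt_mem_nhds one_pos)).exists
  have hu : IsUnit (1 - K ^ n) := isUnit_one_sub_of_norm_lt_one
    (R := C(Icc (0 : ℝ) T, E) →L[ℝ] C(Icc (0 : ℝ) T, E)) ((hnorm n).trans_lt hn)
  rw [← mul_neg_geom_sum] at hu
  have hcomm : Commute (1 - K) (∑ i ∈ Finset.range n, K ^ i) :=
    Commute.sum_right _ _ _ fun i _ => ((Commute.one_left K).sub_left rfl).pow_right i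
  exact (hcomm.isUnit_mul_iff.1 hu).1

end Volterra

/-! ### The nonlinear Volterra equation of a continuously differentiable field -/

section Nonlinear

variable {d : ℕ} {Ψ : ℝ → PhaseSpace d → PhaseSpace d} {T : ℝ}

/-- The superposition operator `u ↦ (s ↦ Ψ(u(s),s))` on continuous paths. -/
def superposition (hΨ : IsC1Field Ψ T) (u : C(Icc (0 : ℝ) T, PhaseSpace d)) :
    C(Icc (0 : ℝ) T, PhaseSpace d) :=
  ⟨fun s => Ψ s (u s), hΨ.continuousOn.comp_continuous
    (f := fun s : Icc (0 : ℝ) T => ((s : ℝ), u s)) (by fun_prop) fun s => ⟨s.2, mem_univ _⟩⟩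

/-- The path of space Jacobians of the field along a continuous path. -/
def jacobianAlong (hΨ : IsC1Field Ψ T) (u : C(Icc (0 : ℝ) T, PhaseSpace d)) :
    C(Icc (0 : ℝ) T, PhaseSpace d →L[ℝ] PhaseSpace d) :=
  ⟨fun s => fderiv ℝ (Ψ s) (u s), hΨ.continuousOn_fderiv.comp_continuous
    (f := fun s : Icc (0 : ℝ) T => ((s : ℝ), u s)) (by fun_prop) fun s => ⟨s.2, mem_univ _⟩⟩

theorem superposition_apply (hΨ : IsC1Field Ψ T) (u : C(Icc (0 : ℝ) T, PhaseSpace d))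
    (s : Icc (0 : ℝ) T) : superposition hΨ u s = Ψ s (u s) := rfl

theorem IsC1Field.exists_lipschitz (hΨ : IsC1Field Ψ T) (R : ℝ) :
    ∃ M, 0 ≤ M ∧ ∀ s ∈ Icc 0 T, ∀ z ∈ Metric.closedBall (0 : PhaseSpace d) R,
      ∀ w ∈ Metric.closedBall (0 : PhaseSpace d) R, ‖Ψ s z - Ψ s w‖ ≤ M * ‖z - w‖ := by
  have hK : IsCompact (Icc 0 T ×ˢ Metric.closedBall (0 : PhaseSpace d) R) :=
    isCompact_Icc.prod (isCompact_closedBall _ _)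
  obtain ⟨M, hM⟩ := hK.exists_bound_of_continuousOn
    (hΨ.continuousOn_fderiv.mono (prod_mono_right (subset_univ _)))
  refine ⟨max M 0, le_max_right _ _, fun s hs z hz w hw => ?_⟩
  exact (convex_closedBall (0 : PhaseSpace d) R).norm_image_sub_le_of_norm_fderiv_le
    (𝕜 := ℝ) (fun y _ => (hΨ.differentiable s hs) y)
    (fun y hy => (hM (s, y) ⟨hs, hy⟩).trans (le_max_left _ _)) hw hz

theorem hasStrictFDerivAt_superposition (hΨ : IsC1Field Ψ T)
    (u : C(Icc (0 : ℝ) T, PhaseSpace d)) :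
    HasStrictFDerivAt (superposition hΨ) (pathApply (jacobianAlong hΨ u)) u := by
  refine .of_isLittleO (Asymptotics.isLittleO_iff.2 fun ε hε => ?_)
  have hK : IsCompact (Icc 0 T ×ˢ Metric.closedBall (0 : PhaseSpace d) (‖u‖ + 1)) :=
    isCompact_Icc.prod (isCompact_closedBall _ _)
  have huc := hK.uniformContinuousOn_of_continuous
    (hΨ.continuousOn_fderiv.mono (prod_mono_right (subset_univ _)))
  obtain ⟨δ, hδ, h⟩ := Metric.uniformContinuousOn_iff_le.1 huc ε hε
  have hr : 0 < min δ 1 := lt_min hδ one_pos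
  filter_upwards [prod_mem_nhds (Metric.ball_mem_nhds u hr) (Metric.ball_mem_nhds u hr)]
    with p hp
  refine (ContinuousMap.norm_le _ (by positivity)).2 fun s => ?_
  have hball : ∀ v ∈ Metric.ball u (min δ 1), v s ∈ Metric.ball (u s) (min δ 1) := fun v hv =>
    (ContinuousMap.dist_apply_le_dist s).trans_lt hv
  have hsub : ∀ y ∈ Metric.ball (u s) (min δ 1),
      y ∈ Metric.closedBall (0 : PhaseSpace d) (‖u‖ + 1) := fun y hy => by
    rw [mem_closedBall_zero_iff]
    rw [mem_ball_iff_norm] at hy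
    have h1 := u.norm_coe_le_norm s
    have h2 := norm_le_norm_add_norm_sub' y (u s)
    have h3 := min_le_right δ 1
    linarith
  have hu : u s ∈ Metric.closedBall (0 : PhaseSpace d) (‖u‖ + 1) :=
    hsub _ (Metric.mem_ball_self hr)
  refine ((convex_ball (u s) (min δ 1)).norm_image_sub_le_of_norm_fderiv_le' (𝕜 := ℝ)
    (f := Ψ s) (φ := fderiv ℝ (Ψ s) (u s)) (C := ε)
    (fun y _ => (hΨ.differentiable s s.2) y) (fun y hy => ?_) (hball _ hp.2)
    (hball _ hp.1)).trans ?_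
  · rw [← dist_eq_norm]
    refine h (s, y) ⟨s.2, hsub y hy⟩ (s, u s) ⟨s.2, hu⟩ ?_
    rw [Prod.dist_eq, dist_self]
    exact max_le hδ.le ((Metric.mem_ball.1 hy).le.trans (min_le_left _ _))
  · exact mul_le_mul_of_nonneg_left ((p.1 - p.2).norm_coe_le_norm s) hε.le

/-- The map `u ↦ (τ ↦ u(τ) - ∫₀^τ c(s) Ψ(u(s),s) ds)`. A path `u` solves the equation
`du/ds = c Ψ(u,s)` with forcing `g` and initial value included in `g`, in integrated form, exactly
if it is mapped to `g`. -/
def volterraMap {c : ℝ → ℝ} (hΨ : IsC1Field Ψ T) (hc : IsWeight c) (hT : 0 ≤ T)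
    (u : C(Icc (0 : ℝ) T, PhaseSpace d)) : C(Icc (0 : ℝ) T, PhaseSpace d) :=
  u - weightedPrimitive hc hT (superposition hΨ u)

variable {c : ℝ → ℝ}

theorem hasStrictFDerivAt_volterraMap (hΨ : IsC1Field Ψ T) (hc : IsWeight c) (hT : 0 ≤ T)
    (u : C(Icc (0 : ℝ) T, PhaseSpace d)) :
    HasStrictFDerivAt (volterraMap hΨ hc hT)
      (1 - weightedPrimitive hc hT ∘L pathApply (jacobianAlong hΨ u)) u :=
  (hasStrictFDerivAt_id u).sub
    ((weightedPrimitive hc hT).hasStrictFDerivAt.comp u (hasStrictFDerivAt_superposition hΨ u))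

/-- Solutions of the nonlinear equation are unique for each forcing. -/
theorem volterraMap_injective (hΨ : IsC1Field Ψ T) (hc : IsWeight c) (hT : 0 ≤ T) :
    Function.Injective (volterraMap hΨ hc hT) := by
  intro u v huv
  obtain ⟨M, hM0, hM⟩ := hΨ.exists_lipschitz (max ‖u‖ ‖v‖)
  have hdiff : u - v = weightedPrimitive hc hT (superposition hΨ u - superposition hΨ v) := by
    rw [map_sub]
    simp only [volterraMap] at huv
    rw [sub_eq_sub_iff_sub_eq_sub] at huv
    exact huv
  have key : ∀ (n : ℕ) (τ : Icc (0 : ℝ) T),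
      ‖(u - v) τ‖ ≤ ‖u - v‖ * (M * τ) ^ n / n.factorial := by
    intro n
    induction n with
    | zero => intro τ; simpa using (u - v).norm_coe_le_norm τ
    | succ n ih =>
      intro τ
      have step := norm_weightedPrimitive_le hc hT (superposition hΨ u - superposition hΨ v)
        (M := M) (C := ‖u - v‖) (n := n) (fun s => ?_) τ
      · rwa [← hdiff] at step
      refine (hM s s.2 (u s) ?_ (v s) ?_).trans ?_
      · exact mem_closedBall_zero_iff.2 ((u.norm_coe_le_norm s).trans (le_max_left _ _))
      · exact mem_closedBall_zero_iff.2 ((v.norm_coe_le_norm s).trans (le_max_right _ _))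
      · exact mul_le_mul_of_nonneg_left (ih s) hM0
  ext1 τ
  rw [← sub_eq_zero, ← norm_le_zero_iff]
  have := (FloorSemiring.tendsto_pow_div_factorial_atTop (M * (τ : ℝ))).const_mul ‖u - v‖
  rw [mul_zero] at this
  exact ge_of_tendsto' this fun n => (key n τ).trans_eq (mul_div_assoc _ _ _)

/-- The inverse function theorem for `volterraMap`: near the forcing of a given solution `u` there
is a solution for each forcing, and it depends differentiably on the forcing. -/
theorem exists_differentiable_solution (hΨ : IsC1Field Ψ T) (hc : IsWeight c) (hT : 0 ≤ T)
    (u : C(Icc (0 : ℝ) T, PhaseSpace d)) :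
    ∃ (R : C(Icc (0 : ℝ) T, PhaseSpace d) →L[ℝ] C(Icc (0 : ℝ) T, PhaseSpace d))
      (sol : C(Icc (0 : ℝ) T, PhaseSpace d) → C(Icc (0 : ℝ) T, PhaseSpace d)),
      (∀ g v, v = R g ↔
        v = weightedPrimitive hc hT (pathApply (jacobianAlong hΨ u) v) + g) ∧
      (∀ᶠ g in 𝓝 (volterraMap hΨ hc hT u), ∀ v, volterraMap hΨ hc hT v = g ↔ v = sol g) ∧
      HasFDerivAt sol R (volterraMap hΨ hc hT u) := by
  obtain ⟨k, hk⟩ := isUnit_one_sub_weightedPrimitive hc hT (jacobianAlong hΨ u)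
  have hd := hasStrictFDerivAt_volterraMap hΨ hc hT u
  rw [← hk] at hd
  change HasStrictFDerivAt _ (ContinuousLinearEquiv.ofUnit k :
    C(Icc (0 : ℝ) T, PhaseSpace d) →L[ℝ] C(Icc (0 : ℝ) T, PhaseSpace d)) u at hd
  refine ⟨(ContinuousLinearEquiv.ofUnit k).symm, hd.localInverse _ _ _, fun g v => ?_, ?_,
    hd.to_localInverse.hasFDerivAt⟩
  · have h1 : ContinuousLinearEquiv.ofUnit k v =
        v - weightedPrimitive hc hT (pathApply (jacobianAlong hΨ u) v) :=
      congrArg (fun f : C(Icc (0 : ℝ) T, PhaseSpace d) →L[ℝ] C(Icc (0 : ℝ) T, PhaseSpace d) => f v)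
        hk
    rw [ContinuousLinearEquiv.coe_coe, ContinuousLinearEquiv.eq_symm_apply, h1,
      sub_eq_iff_eq_add']
  · filter_upwards [hd.eventually_right_inverse] with g hg v
    exact ⟨fun h => volterraMap_injective hΨ hc hT (h.trans hg.symm), fun h => h ▸ hg⟩

end Nonlinear

/-! ### The forward-backward evolution as a Volterra equation -/

section ForwardBackward

variable {d : ℕ} {Φ : ℝ → PhaseSpace d → PhaseSpace d} {t : ℝ} {x : PhaseSpace d}
  {S : ℝ → PhaseSpace d → PhaseSpace d}

/-- The sign of the forward-backward field: `1` before the reversal time `t` and `-1` after it. -/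
def reversalSign (t s : ℝ) : ℝ := if s < t then 1 else -1

theorem isWeight_reversalSign (t : ℝ) : IsWeight (reversalSign t) where
  measurable := Measurable.ite measurableSet_Iio measurable_const measurable_const
  norm_le_one s := by unfold reversalSign; split_ifs <;> simp

theorem min_of_lt_reversal {s : ℝ} (h : s < t) : min s (2 * t - s) = s :=
  min_eq_left (by linarith)

theorem min_of_reversal_le {s : ℝ} (h : t ≤ s) : min s (2 * t - s) = 2 * t - s :=
  min_eq_right (by linarith)

theorem reversal_mem_Icc {s : ℝ} (hs : s ∈ Icc 0 (2 * t)) : min s (2 * t - s) ∈ Icc 0 t := by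
  refine ⟨le_min hs.1 (by linarith [hs.2]), ?_⟩
  rcases lt_or_ge s t with h | h
  · exact (min_le_left _ _).trans h.le
  · exact (min_le_right _ _).trans (by linarith)

theorem bfField_eq_smul (Φ : ℝ → PhaseSpace d → PhaseSpace d) (t s : ℝ) (z : PhaseSpace d) :
    bfField Φ t s z = reversalSign t s • Φ (min s (2 * t - s)) z := by
  unfold bfField reversalSign
  split_ifs with h
  · rw [min_of_lt_reversal h, one_smul]
  · rw [min_of_reversal_le (not_lt.1 h), neg_one_smul]

/-- Up to the sign, the forward-backward field is continuous through the reversal time. -/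
theorem IsC1Field.reversal (hΦ : IsC1Field Φ t) :
    IsC1Field (fun s => Φ (min s (2 * t - s))) (2 * t) where
  continuousOn := hΦ.continuousOn.comp
    (f := fun p : ℝ × PhaseSpace d => (min p.1 (2 * t - p.1), p.2)) (by fun_prop)
    fun _ hp => ⟨reversal_mem_Icc hp.1, mem_univ _⟩
  differentiable s hs := hΦ.differentiable _ (reversal_mem_Icc hs)
  continuousOn_fderiv := hΦ.continuousOn_fderiv.comp
    (f := fun p : ℝ × PhaseSpace d => (min p.1 (2 * t - p.1), p.2)) (by fun_prop)
    fun _ hp => ⟨reversal_mem_Icc hp.1, mem_univ _⟩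

theorem uIcc_subset_Icc_of_mem {T : ℝ} (τ : Icc (0 : ℝ) T) : uIcc 0 (τ : ℝ) ⊆ Icc 0 T :=
  uIcc_subset_Icc ⟨le_rfl, τ.2.1.trans τ.2.2⟩ τ.2

theorem weightedPrimitive_eq_integral {E : Type*} [NormedAddCommGroup E] [NormedSpace ℝ E]
    {T : ℝ} {c : ℝ → ℝ} (hc : IsWeight c) (hT : 0 ≤ T) {h : C(Icc (0 : ℝ) T, E)} {f : ℝ → E}
    (hf : ∀ s : Icc (0 : ℝ) T, c s • h s = f s) (τ : Icc (0 : ℝ) T) :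
    weightedPrimitive hc hT h τ = ∫ s in (0 : ℝ)..τ, f s := by
  rw [weightedPrimitive_apply]
  refine intervalIntegral.integral_congr fun s hs => ?_
  have hs' := uIcc_subset_Icc_of_mem τ hs
  rw [IccExtend_of_mem hT _ hs']
  exact hf ⟨s, hs'⟩

theorem exists_path {E : Type*} [TopologicalSpace E] {T : ℝ} {y : ℝ → E}
    (hy : ContinuousOn y (Icc 0 T)) : ∃ u : C(Icc (0 : ℝ) T, E), ∀ τ, u τ = y τ :=
  ⟨⟨fun τ => y τ, hy.domRestrict⟩, fun _ => rfl⟩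

theorem continuousOn_of_path {E : Type*} [TopologicalSpace E] {T : ℝ} {y : ℝ → E}
    {u : C(Icc (0 : ℝ) T, E)} (h : ∀ τ, u τ = y τ) : ContinuousOn y (Icc 0 T) := by
  rw [continuousOn_iff_continuous_domRestrict]
  convert u.continuous using 1
  ext1 τ
  exact (h τ).symm

/-- The equation of the forward-backward evolution with noise, as an equation between paths. -/
theorem isBFSolution_iff (hΦ : IsC1Field Φ t) (ht : 0 ≤ 2 * t) {N y : ℝ → PhaseSpace d} {ε : ℝ}
    {n : C(Icc (0 : ℝ) (2 * t), PhaseSpace d)} (hn : ∀ τ, n τ = N τ) :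
    IsBFSolution Φ t x N ε y ↔ ∃ u : C(Icc (0 : ℝ) (2 * t), PhaseSpace d), (∀ τ, u τ = y τ) ∧
      volterraMap hΦ.reversal (isWeight_reversalSign t) ht u = .const _ x + ε • n := by
  have key : ∀ u : C(Icc (0 : ℝ) (2 * t), PhaseSpace d), (∀ τ, u τ = y τ) →
      ∀ τ, weightedPrimitive (isWeight_reversalSign t) ht (superposition hΦ.reversal u) τ =
        ∫ s in (0 : ℝ)..τ, bfField Φ t s (y s) := fun u hu =>
    weightedPrimitive_eq_integral _ ht fun s => by
      rw [bfField_eq_smul, superposition_apply, hu]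
  constructor
  · rintro ⟨hy, h⟩
    obtain ⟨u, hu⟩ := exists_path hy
    refine ⟨u, hu, ?_⟩
    ext1 τ
    rw [volterraMap, ContinuousMap.sub_apply, key u hu, hu, h τ τ.2]
    simp only [ContinuousMap.add_apply, ContinuousMap.const_apply, ContinuousMap.smul_apply, hn]
    abel
  · rintro ⟨u, hu, h⟩
    refine ⟨continuousOn_of_path hu, fun τ hτ => ?_⟩
    have h1 := congrArg (fun v : C(Icc (0 : ℝ) (2 * t), PhaseSpace d) => v ⟨τ, hτ⟩) h
    simp only [volterraMap, ContinuousMap.sub_apply, key u hu, hu, ContinuousMap.add_apply,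
      ContinuousMap.const_apply, ContinuousMap.smul_apply, hn] at h1
    rw [sub_eq_iff_eq_add] at h1
    rw [h1]
    abel

/-- The linearized equation along the retraced orbit `u`, as an equation between paths. -/
theorem linearEquation_iff (hΦ : IsC1Field Φ t) (ht : 0 ≤ 2 * t) {N Ξ : ℝ → PhaseSpace d}
    {n u : C(Icc (0 : ℝ) (2 * t), PhaseSpace d)} (hn : ∀ τ, n τ = N τ)
    (hu : ∀ τ, u τ = S (min τ (2 * t - τ)) x) :
    (ContinuousOn Ξ (Icc 0 (2 * t)) ∧
      ∀ τ ∈ Icc 0 (2 * t), Ξ τ = (∫ s in (0 : ℝ)..τ,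
        if s < t then fderiv ℝ (Φ s) (S s x) (Ξ s)
        else -fderiv ℝ (Φ (2 * t - s)) (S (2 * t - s) x) (Ξ s)) + N τ) ↔
    ∃ v : C(Icc (0 : ℝ) (2 * t), PhaseSpace d), (∀ τ, v τ = Ξ τ) ∧
      v = weightedPrimitive (isWeight_reversalSign t) ht
        (pathApply (jacobianAlong hΦ.reversal u) v) + n := by
  have key : ∀ v : C(Icc (0 : ℝ) (2 * t), PhaseSpace d), (∀ τ, v τ = Ξ τ) →
      ∀ τ, weightedPrimitive (isWeight_reversalSign t) ht
          (pathApply (jacobianAlong hΦ.reversal u) v) τ =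
        ∫ s in (0 : ℝ)..τ, if s < t then fderiv ℝ (Φ s) (S s x) (Ξ s)
          else -fderiv ℝ (Φ (2 * t - s)) (S (2 * t - s) x) (Ξ s) := fun v hv =>
    weightedPrimitive_eq_integral _ ht fun s => by
      change _ • fderiv ℝ (Φ (min s.1 (2 * t - s))) (u s) (v s) = _
      rw [hu, hv]
      unfold reversalSign
      split_ifs with h
      · rw [min_of_lt_reversal h, one_smul]
      · rw [min_of_reversal_le (not_lt.1 h), neg_one_smul]
  constructor
  · rintro ⟨hΞ, h⟩
    obtain ⟨v, hv⟩ := exists_path hΞ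
    refine ⟨v, hv, ?_⟩
    ext1 τ
    rw [ContinuousMap.add_apply, key v hv, hv, h τ τ.2, hn]
  · rintro ⟨v, hv, h⟩
    refine ⟨continuousOn_of_path hv, fun τ hτ => ?_⟩
    have h1 := congrArg (fun v : C(Icc (0 : ℝ) (2 * t), PhaseSpace d) => v ⟨τ, hτ⟩) h
    simpa only [ContinuousMap.add_apply, key v hv, hv, hn] using h1

/-- Without noise, the backward evolution retraces the forward orbit. -/
theorem exists_retraced_orbit (hΦ : IsC1Field Φ t) (ht : 0 ≤ 2 * t) {z : PhaseSpace d}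
    (hz : S 0 z = z) (hcurve : IsIntegralCurveOn (fun s => S s z) Φ (Icc 0 t)) :
    ∃ u : C(Icc (0 : ℝ) (2 * t), PhaseSpace d), (∀ τ, u τ = S (min τ (2 * t - τ)) z) ∧
      volterraMap hΦ.reversal (isWeight_reversalSign t) ht u = .const _ z := by
  have hcont : ContinuousOn (fun s => S s z) (Icc 0 t) :=
    fun s hs => (hcurve s hs).continuousWithinAt
  have hp : ContinuousOn (fun τ : ℝ => S (min τ (2 * t - τ)) z) (Icc 0 (2 * t)) :=
    hcont.comp (f := fun τ : ℝ => min τ (2 * t - τ)) (by fun_prop) fun _ hτ => reversal_mem_Icc hτ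
  obtain ⟨u, hu⟩ := exists_path hp
  refine ⟨u, hu, ?_⟩
  ext1 τ
  rw [volterraMap, ContinuousMap.sub_apply, ContinuousMap.const_apply, hu,
    weightedPrimitive_apply]
  have hmem : ∀ r ∈ Icc 0 (2 * t),
      IccExtend ht (superposition hΦ.reversal u) r =
        Φ (min r (2 * t - r)) (S (min r (2 * t - r)) z) := fun r hr => by
    rw [IccExtend_of_mem ht _ hr, superposition_apply, hu]
  rw [integral_eq_of_hasDerivAt_off_countable (fun τ : ℝ => S (min τ (2 * t - τ)) z) _
    (countable_singleton t) (hp.mono (uIcc_subset_Icc_of_mem τ)) ?_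
    ((isWeight_reversalSign t).intervalIntegrable_smul
      (superposition hΦ.reversal u).continuous.Icc_extend'.continuousOn)]
  · simp only [sub_zero, min_eq_left ht, hz, sub_sub_cancel]
  · rintro r ⟨hr, hrt⟩
    rw [min_eq_left τ.2.1, max_eq_right τ.2.1] at hr
    have hr2 : r < 2 * t := hr.2.trans_le τ.2.2
    rw [hmem r ⟨hr.1.le, hr2.le⟩]
    rcases lt_or_gt_of_ne (show r ≠ t from hrt) with h | h
    · have hd := (hcurve r ⟨hr.1.le, h.le⟩).hasDerivAt (Icc_mem_nhds hr.1 h)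
      rw [min_of_lt_reversal h, reversalSign, if_pos h, one_smul]
      refine hd.congr_of_eventuallyEq ?_
      filter_upwards [Iio_mem_nhds h] with q hq
      rw [min_of_lt_reversal hq]
    · have h1 : 0 < 2 * t - r := by linarith
      have h2 : 2 * t - r < t := by linarith
      have hd := (hcurve _ ⟨h1.le, h2.le⟩).hasDerivAt (Icc_mem_nhds h1 h2)
      rw [min_of_reversal_le h.le, reversalSign, if_neg h.not_gt]
      refine (hd.scomp r ((hasDerivAt_id r).const_sub (2 * t))).congr_of_eventuallyEq ?_
      filter_upwards [Ioi_mem_nhds h] with q hq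
      rw [min_of_reversal_le (le_of_lt hq)]
      rfl

/-- The response operator `R` of the forward-backward evolution: it maps a forcing path to the
solution of the linearized equation along the retraced orbit, it is the derivative with respect to
the noise amplitude, and on constant forcings it is the tangent map of the flow. -/
theorem exists_responseOperator (hΦ : IsC1Field Φ t) (h2t : 0 ≤ 2 * t)
    (hS : IsForwardFlow Φ t x S) :
    ∃ (u : C(Icc (0 : ℝ) (2 * t), PhaseSpace d))
      (R : C(Icc (0 : ℝ) (2 * t), PhaseSpace d) →L[ℝ] C(Icc (0 : ℝ) (2 * t), PhaseSpace d)),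
      (∀ τ, u τ = S (min τ (2 * t - τ)) x) ∧
      (∀ g v, v = R g ↔ v = weightedPrimitive (isWeight_reversalSign t) h2t
        (pathApply (jacobianAlong hΦ.reversal u) v) + g) ∧
      (∀ (N : ℝ → PhaseSpace d) (n : C(Icc (0 : ℝ) (2 * t), PhaseSpace d)), (∀ τ, n τ = N τ) →
        (∀ᶠ ε in 𝓝 (0 : ℝ), ∃ y, IsBFSolution Φ t x N ε y) ∧
        ∀ y : ℝ → ℝ → PhaseSpace d, (∀ᶠ ε in 𝓝 (0 : ℝ), IsBFSolution Φ t x N ε (y ε)) →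
          ∀ τ : Icc (0 : ℝ) (2 * t),
            Tendsto (fun ε : ℝ => ε⁻¹ • (y ε τ - y 0 τ)) (𝓝[≠] 0) (𝓝 (R n τ))) ∧
      ∀ (s : ℝ) (hs : s ∈ Icc 0 t), HasFDerivAt (S s)
        (ContinuousMap.evalCLM ℝ (⟨s, hs.1, by linarith [hs.2]⟩ : Icc (0 : ℝ) (2 * t)) ∘L R ∘L
          (ContinuousLinearMap.const ℝ (Icc (0 : ℝ) (2 * t)))) x := by
  obtain ⟨u, hu, hux⟩ := exists_retraced_orbit hΦ h2t hS.self_of_nhds.1 hS.self_of_nhds.2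
  obtain ⟨R, sol, hR, hsol, hd⟩ :=
    exists_differentiable_solution hΦ.reversal (isWeight_reversalSign t) h2t u
  rw [hux] at hsol hd
  refine ⟨u, R, hu, hR, fun N n hn => ?_, fun s hs => ?_⟩
  · have hcurve : HasDerivAt
        (fun ε : ℝ => (.const _ x + ε • n : C(Icc (0 : ℝ) (2 * t), PhaseSpace d))) n 0 := by
      simpa using ((hasDerivAt_id (0 : ℝ)).smul_const n).const_add (.const _ x)
    have h0 : (.const _ x + (0 : ℝ) • n : C(Icc (0 : ℝ) (2 * t), PhaseSpace d)) = .const _ x := by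
      ext1 τ
      simp
    have hev : ∀ᶠ ε in 𝓝 (0 : ℝ), ∀ v,
        volterraMap hΦ.reversal (isWeight_reversalSign t) h2t v = .const _ x + ε • n ↔
          v = sol (.const _ x + ε • n) := by
      exact hcurve.continuousAt.eventually (p := fun g => ∀ v,
        volterraMap hΦ.reversal (isWeight_reversalSign t) h2t v = g ↔ v = sol g)
        (by simpa only [h0] using hsol)
    refine ⟨?_, fun y hy τ => ?_⟩
    · filter_upwards [hev] with ε hε
      refine ⟨IccExtend h2t (sol (.const _ x + ε • n)),
        (isBFSolution_iff hΦ h2t hn).2 ⟨_, fun τ => ?_, (hε _).2 rfl⟩⟩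
      rw [IccExtend_val]
    · have heq : ∀ᶠ ε in 𝓝 (0 : ℝ), y ε τ = sol (.const _ x + ε • n) τ := by
        filter_upwards [hy, hev] with ε h1 h2
        obtain ⟨v, hv, hv2⟩ := (isBFSolution_iff hΦ h2t hn).1 h1
        rw [← hv, (h2 v).1 hv2]
      have hder : HasDerivAt (fun ε => y ε τ) (R n τ) 0 := by
        have hd' : HasFDerivAt sol R (.const _ x + (0 : ℝ) • n) := by rwa [h0]
        have h3 := (ContinuousMap.evalCLM ℝ τ).hasFDerivAt.comp_hasDerivAt (0 : ℝ)
          (hd'.comp_hasDerivAt (0 : ℝ) hcurve)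
        exact h3.congr_of_eventuallyEq heq
      have := hasDerivAt_iff_tendsto_slope.1 hder
      refine this.congr fun ε => ?_
      rw [slope_def_module, sub_zero]
  · have hconst : ContinuousAt
        (fun z : PhaseSpace d => (.const _ z : C(Icc (0 : ℝ) (2 * t), PhaseSpace d))) x :=
      (ContinuousLinearMap.const ℝ (Icc (0 : ℝ) (2 * t))).continuous.continuousAt
    have h1 : HasFDerivAt
        (fun z : PhaseSpace d => (.const _ z : C(Icc (0 : ℝ) (2 * t), PhaseSpace d)))
        (ContinuousLinearMap.const ℝ (Icc (0 : ℝ) (2 * t))) x :=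
      (ContinuousLinearMap.const ℝ (Icc (0 : ℝ) (2 * t)) :
        PhaseSpace d →L[ℝ] C(Icc (0 : ℝ) (2 * t), PhaseSpace d)).hasFDerivAt
    have h2 := ((ContinuousMap.evalCLM ℝ
      (⟨s, hs.1, by linarith [hs.2]⟩ : Icc (0 : ℝ) (2 * t))).hasFDerivAt).comp x
      (HasFDerivAt.comp x hd h1)
    refine h2.congr_of_eventuallyEq ?_
    filter_upwards [hS, hconst.eventually hsol] with z hz hzsol
    obtain ⟨v, hv, hvz⟩ := exists_retraced_orbit hΦ h2t hz.1 hz.2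
    have h3 := (hzsol v).1 hvz
    have h4 := hv ⟨s, hs.1, by linarith [hs.2]⟩
    rw [h3] at h4
    change S s z = sol (.const _ z) _
    rw [h4]
    simp only
    rw [min_eq_left (by linarith [hs.2])]

end ForwardBackward

/-! ### The inverse tangent map and variation of constants -/

section Propagator

theorem isWeight_one : IsWeight fun _ => (1 : ℝ) :=
  ⟨measurable_const, fun _ => by simp⟩

/-- For a linear equation `p' = A p` there is a solution `M` of the adjoint equation `M' = -M A`
with `M(0) = 1`, that is, the inverse of the propagator, and the variation of constants formula
holds: if `p` solves the equation with the forcing `V` in integrated form then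
`(M (p - V))' = M A V = -M' V`. -/
theorem exists_inverse_propagator {E : Type*} [NormedAddCommGroup E] [NormedSpace ℝ E]
    [CompleteSpace E] {A : ℝ → E →L[ℝ] E} (hA : Continuous A) {T : ℝ} (hT : 0 ≤ T) :
    ∃ M D : ℝ → E →L[ℝ] E, Continuous D ∧ (∀ s, HasDerivAt M (D s) s) ∧
      ∀ (p V : ℝ → E) (p₀ : E), Continuous p → Continuous V →
        (∀ τ ∈ Icc 0 T, p τ = (∫ s in (0 : ℝ)..τ, A s (p s)) + p₀ + V τ) →
        ∀ τ ∈ Icc 0 T, M τ (p τ - V τ) = p₀ - ∫ s in (0 : ℝ)..τ, D s (V s) := by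
  -- The adjoint equation is a Volterra equation in the Banach space of operators.
  let B : C(Icc (0 : ℝ) T, (E →L[ℝ] E) →L[ℝ] (E →L[ℝ] E)) :=
    ⟨fun s => -((ContinuousLinearMap.compL ℝ E E E).flip (A s)), by fun_prop⟩
  obtain ⟨k, hk⟩ := isUnit_one_sub_weightedPrimitive isWeight_one hT B
  set m : C(Icc (0 : ℝ) T, E →L[ℝ] E) :=
    (ContinuousLinearEquiv.ofUnit k).symm (.const _ (.id ℝ E)) with hm
  have hm1 : m - weightedPrimitive isWeight_one hT (pathApply B m) = .const _ (.id ℝ E) := by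
    have h1 : ContinuousLinearEquiv.ofUnit k m =
        m - weightedPrimitive isWeight_one hT (pathApply B m) :=
      congrArg (fun f : C(Icc (0 : ℝ) T, E →L[ℝ] E) →L[ℝ] C(Icc (0 : ℝ) T, E →L[ℝ] E) => f m) hk
    rw [← h1, hm, ContinuousLinearEquiv.apply_symm_apply]
  set μ : ℝ → E →L[ℝ] E := IccExtend hT m with hμ
  have hμc : Continuous μ := m.continuous.Icc_extend'
  set D : ℝ → E →L[ℝ] E := fun s => -(μ s ∘L A s) with hD
  have hDc : Continuous D := (hμc.clm_comp hA).neg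
  set M : ℝ → E →L[ℝ] E := fun τ => .id ℝ E + ∫ s in (0 : ℝ)..τ, D s with hM
  have hMd : ∀ s, HasDerivAt M (D s) s := fun s =>
    (intervalIntegral.integral_hasDerivAt_right (hDc.intervalIntegrable _ _)
      (hDc.stronglyMeasurableAtFilter _ _) hDc.continuousAt).const_add _
  have hMμ : ∀ τ ∈ Icc 0 T, M τ = μ τ := fun τ hτ => by
    have h1 := congrArg (fun f : C(Icc (0 : ℝ) T, E →L[ℝ] E) => f ⟨τ, hτ⟩) hm1
    simp only [ContinuousMap.sub_apply, ContinuousMap.const_apply] at h1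
    rw [sub_eq_iff_eq_add, weightedPrimitive_eq_integral (f := D) isWeight_one hT] at h1
    · rw [hμ, IccExtend_of_mem hT _ hτ, h1]
    · intro s
      rw [one_smul, hD, hμ]
      simp only [IccExtend_val]
      rfl
  refine ⟨M, D, hDc, hMd, fun p V p₀ hp hV hpV τ hτ => ?_⟩
  set h : ℝ → E := fun τ => (∫ s in (0 : ℝ)..τ, A s (p s)) + p₀ with hh
  have hAp : Continuous fun s => A s (p s) := hA.clm_apply hp
  have hhd : ∀ s, HasDerivAt h (A s (p s)) s := fun s =>
    (intervalIntegral.integral_hasDerivAt_right (hAp.intervalIntegrable _ _)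
      (hAp.stronglyMeasurableAtFilter _ _) hAp.continuousAt).add_const _
  have hder : ∀ s ∈ uIcc 0 τ, HasDerivAt (fun s => M s (h s)) (-(D s (V s))) s := fun s hs => by
    rw [uIcc_of_le hτ.1] at hs
    have hs' : s ∈ Icc 0 T := ⟨hs.1, hs.2.trans hτ.2⟩
    refine ((hMd s).clm_apply (hhd s)).congr_deriv ?_
    have h1 : p s = h s + V s := hpV s hs'
    rw [hMμ s hs', h1]
    simp [hD]
  have hftc := intervalIntegral.integral_eq_sub_of_hasDerivAt hder
    ((hDc.clm_apply hV).neg.intervalIntegrable _ _)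
  rw [intervalIntegral.integral_neg] at hftc
  have h1 : p τ - V τ = h τ := by rw [hpV τ hτ, add_sub_cancel_right]
  have h0 : M 0 (h 0) = p₀ := by simp [hM, hh]
  rw [h1, sub_eq_add_neg, hftc, h0]
  abel

variable {d : ℕ} {Φ : ℝ → PhaseSpace d → PhaseSpace d} {t : ℝ} {x : PhaseSpace d}
  {S : ℝ → PhaseSpace d → PhaseSpace d}

theorem integral_reversalSign_of_le {E : Type*} [NormedAddCommGroup E] [NormedSpace ℝ E]
    (f : ℝ → E) {a b : ℝ} (hab : a ≤ b) (hb : b ≤ t) :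
    ∫ s in a..b, reversalSign t s • f s = ∫ s in a..b, f s := by
  refine intervalIntegral.integral_congr_Ioo_of_le hab fun s hs => ?_
  simp only [reversalSign, if_pos (hs.2.trans_le hb), one_smul]

theorem integral_reversalSign_of_ge {E : Type*} [NormedAddCommGroup E] [NormedSpace ℝ E]
    (f : ℝ → E) {a b : ℝ} (hab : a ≤ b) (ha : t ≤ a) :
    ∫ s in a..b, reversalSign t s • f s = -∫ s in a..b, f s := by
  rw [← intervalIntegral.integral_neg]
  refine intervalIntegral.integral_congr_Ioo_of_le hab fun s hs => ?_
  simp only [reversalSign, if_neg (ha.trans hs.1.le).not_gt, neg_one_smul]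

/-- Subtracting the backward from the forward part of the linear response, one obtains a process
`p(s) = v(s) - v(2t-s)` which starts from `-v(2t)`, vanishes at the reversal time and is driven by
the folded forcing. Variation of constants then gives `v(2t)`; the integral `∫₀ᵗ M dV` appears
after an integration by parts. -/
theorem exists_response_formula (ht : 0 < t) (hΦ : IsC1Field Φ t) (h2t : 0 ≤ 2 * t)
    {u : C(Icc (0 : ℝ) (2 * t), PhaseSpace d)} (hu : ∀ τ, u τ = S (min τ (2 * t - τ)) x)
    {R : C(Icc (0 : ℝ) (2 * t), PhaseSpace d) →L[ℝ] C(Icc (0 : ℝ) (2 * t), PhaseSpace d)}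
    (hR : ∀ g v, v = R g ↔ v = weightedPrimitive (isWeight_reversalSign t) h2t
        (pathApply (jacobianAlong hΦ.reversal u) v) + g) :
    ∃ M D : ℝ → PhaseSpace d →L[ℝ] PhaseSpace d, Continuous D ∧ (∀ s, HasDerivAt M (D s) s) ∧
      (∀ (s : Icc (0 : ℝ) (2 * t)), (s : ℝ) ≤ t → ∀ v, M s (R (.const _ v) s) = v) ∧
      ∀ (N : ℝ → PhaseSpace d) (n : C(Icc (0 : ℝ) (2 * t), PhaseSpace d)), (∀ τ, n τ = N τ) →
        R n ⟨2 * t, h2t, le_rfl⟩ = M t (N t + (N (2 * t) - N (2 * t - t))) -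
          ∫ s in (0 : ℝ)..t, D s (N s + (N (2 * t) - N (2 * t - s))) := by
  set A : ℝ → PhaseSpace d →L[ℝ] PhaseSpace d := IccExtend h2t (jacobianAlong hΦ.reversal u)
    with hA
  have hAc : Continuous A := (jacobianAlong hΦ.reversal u).continuous.Icc_extend'
  have hsymm : ∀ s ∈ Icc 0 (2 * t), A (2 * t - s) = A s := fun s hs => by
    have hs' : 2 * t - s ∈ Icc 0 (2 * t) := ⟨by linarith [hs.2], by linarith [hs.1]⟩
    rw [hA, IccExtend_of_mem h2t _ hs, IccExtend_of_mem h2t _ hs']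
    change fderiv ℝ (Φ (min (2 * t - s) (2 * t - (2 * t - s)))) (u ⟨2 * t - s, hs'⟩) =
      fderiv ℝ (Φ (min s (2 * t - s))) (u ⟨s, hs⟩)
    rw [hu, hu]
    simp only [sub_sub_cancel, min_comm]
  obtain ⟨M, D, hD, hMD, hvar⟩ := exists_inverse_propagator hAc ht.le
  have hsol : ∀ g τ, (hτ : τ ∈ Icc 0 (2 * t)) → IccExtend h2t (R g) τ =
      (∫ s in (0 : ℝ)..τ, reversalSign t s • A s (IccExtend h2t (R g) s)) +
        g ⟨τ, hτ⟩ := fun g τ hτ => by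
    have h1 := congrArg (fun f : C(Icc (0 : ℝ) (2 * t), PhaseSpace d) => f ⟨τ, hτ⟩)
      ((hR g (R g)).1 rfl)
    simp only [ContinuousMap.add_apply] at h1
    rw [IccExtend_of_mem h2t _ hτ, h1]
    rfl
  have hcont : ∀ g, Continuous (IccExtend h2t (R g)) := fun g => (R g).continuous.Icc_extend'
  refine ⟨M, D, hD, hMD, fun s hs v => ?_, fun N n hn => ?_⟩
  · have h1 := hvar (IccExtend h2t (R (.const _ v))) (fun _ => 0) v (hcont _) continuous_const
      (fun τ hτ => ?_) s ⟨s.2.1, hs⟩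
    · simpa using h1
    · rw [hsol _ τ ⟨hτ.1, by linarith [hτ.2]⟩, integral_reversalSign_of_le _ hτ.1 hτ.2]
      simp
  · set v := IccExtend h2t (R n) with hv
    set V : ℝ → PhaseSpace d := fun s =>
      IccExtend h2t n s + (IccExtend h2t n (2 * t) - IccExtend h2t n (2 * t - s)) with hV
    have hnc : Continuous (IccExtend h2t n) := n.continuous.Icc_extend'
    have hN : ∀ s ∈ Icc 0 (2 * t), IccExtend h2t n s = N s := fun s hs => by
      rw [IccExtend_of_mem h2t _ hs, hn]
    have hVN : ∀ s ∈ Icc 0 t, V s = N s + (N (2 * t) - N (2 * t - s)) := fun s hs => by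
      simp only [hV]
      rw [hN s ⟨hs.1, by linarith [hs.2]⟩, hN _ ⟨h2t, le_rfl⟩,
        hN _ ⟨by linarith [hs.2], by linarith [hs.1]⟩]
    have hf : Continuous fun s => A s (v s) := hAc.clm_apply (hcont n)
    have hf' : Continuous fun s => A s (v (2 * t - s)) :=
      hAc.clm_apply ((hcont n).comp (by fun_prop))
    have h1 := hvar (fun s => v s - v (2 * t - s)) V (-v (2 * t))
      ((hcont n).sub ((hcont n).comp (by fun_prop))) (by fun_prop) (fun τ hτ => ?_) t
      ⟨ht.le, le_rfl⟩
    · have h2 : 2 * t - t = t := by ring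
      rw [h2, sub_self, zero_sub, map_neg, hVN t ⟨ht.le, le_rfl⟩, h2] at h1
      have h3 : v (2 * t) = R n ⟨2 * t, h2t, le_rfl⟩ := IccExtend_of_mem h2t _ ⟨h2t, le_rfl⟩
      have h4 : ∫ s in (0 : ℝ)..t, D s (V s) =
          ∫ s in (0 : ℝ)..t, D s (N s + (N (2 * t) - N (2 * t - s))) := by
        refine intervalIntegral.integral_congr fun s hs => ?_
        rw [uIcc_of_le ht.le] at hs
        simp only [hVN s hs]
      rw [h2, ← h3, ← h4]
      rw [eq_sub_iff_add_eq, ← neg_inj, neg_add', h1]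
    · have hτ1 : τ ∈ Icc 0 (2 * t) := ⟨hτ.1, by linarith [hτ.2]⟩
      have hτ2 : 2 * t - τ ∈ Icc 0 (2 * t) := ⟨by linarith [hτ.2], by linarith [hτ.1]⟩
      have e1 := hsol n τ hτ1
      have e2 := hsol n (2 * t) ⟨h2t, le_rfl⟩
      have e3 := hsol n (2 * t - τ) hτ2
      have hint : ∀ a b, IntervalIntegrable (fun s => reversalSign t s • A s (v s)) volume a b :=
        fun a b => (isWeight_reversalSign t).intervalIntegrable_smul hf.continuousOn
      rw [integral_reversalSign_of_le _ hτ.1 hτ.2] at e1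
      -- the increment of the backward part, reflected at the reversal time
      have e4 : (∫ s in (0 : ℝ)..(2 * t), reversalSign t s • A s (v s)) -
          (∫ s in (0 : ℝ)..(2 * t - τ), reversalSign t s • A s (v s)) =
          -∫ s in (0 : ℝ)..τ, A s (v (2 * t - s)) := by
        rw [intervalIntegral.integral_interval_sub_left (hint _ _) (hint _ _),
          integral_reversalSign_of_ge _ (by linarith [hτ.1]) (by linarith [hτ.2])]
        congr 1
        have h5 := intervalIntegral.integral_comp_sub_left (a := 0) (b := τ)
          (fun s => A s (v s)) (2 * t)
        rw [sub_zero] at h5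
        rw [← h5]
        refine intervalIntegral.integral_congr fun s hs => ?_
        rw [uIcc_of_le hτ.1] at hs
        rw [hsymm s ⟨hs.1, hs.2.trans hτ1.2⟩]
      have e5 : ∫ s in (0 : ℝ)..τ, A s (v s - v (2 * t - s)) =
          (∫ s in (0 : ℝ)..τ, A s (v s)) - ∫ s in (0 : ℝ)..τ, A s (v (2 * t - s)) := by
        rw [← intervalIntegral.integral_sub (hf.intervalIntegrable _ _)
          (hf'.intervalIntegrable _ _)]
        simp only [map_sub]
      rw [e5]
      simp only [hV]
      rw [hN _ hτ1, hN _ hτ2, hN _ ⟨h2t, le_rfl⟩]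
      rw [hn] at e1 e2 e3
      simp only at e1 e2 e3
      rw [← hv] at e1 e2 e3
      rw [sub_eq_iff_eq_add] at e4
      rw [e2, e4, e3, e1]
      abel

end Propagator

/-! ### Integrals of processes with continuous paths -/

section PathIntegral

theorem uniformPoint_mem {a b : ℝ} (hab : a ≤ b) {n k : ℕ} (hk : k ≤ n) :
    a + k * ((b - a) / n) ∈ Icc a b := by
  have h0 : 0 ≤ b - a := sub_nonneg.2 hab
  have h1 : (k : ℝ) * ((b - a) / n) ≤ b - a := by
    rw [← mul_div_assoc]
    refine div_le_of_le_mul₀ (by positivity) h0 ?_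
    rw [mul_comm]
    exact mul_le_mul_of_nonneg_left (by exact_mod_cast hk) h0
  have h2 : 0 ≤ (k : ℝ) * ((b - a) / n) := by positivity
  exact ⟨by linarith, by linarith⟩

theorem tendsto_uniform_riemannSum {E : Type*} [NormedAddCommGroup E] [NormedSpace ℝ E]
    [CompleteSpace E] {f : ℝ → E} {a b : ℝ} (hab : a ≤ b) (hf : ContinuousOn f (Icc a b)) :
    Tendsto (fun n : ℕ => ∑ k ∈ Finset.range n, ((b - a) / n) • f (a + k * ((b - a) / n)))
      atTop (𝓝 (∫ s in a..b, f s)) := by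
  rw [Metric.tendsto_atTop]
  intro ε hε
  have hε' : 0 < ε / (b - a + 1) := by
    have : 0 < b - a + 1 := by linarith
    positivity
  obtain ⟨δ, hδ, huc⟩ := Metric.uniformContinuousOn_iff_le.1
    (isCompact_Icc.uniformContinuousOn_of_continuous hf) _ hε'
  obtain ⟨n₀, hn₀⟩ := exists_nat_gt ((b - a) / δ)
  refine ⟨n₀ + 1, fun n hn => ?_⟩
  have hn1 : 0 < (n : ℝ) := by exact_mod_cast (Nat.succ_pos n₀).trans_le hn
  have hn2 : (n₀ : ℝ) ≤ n := by exact_mod_cast (Nat.le_succ n₀).trans hn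
  set h := (b - a) / n with hh
  have hh0 : 0 ≤ h := div_nonneg (by linarith) hn1.le
  have hhδ : h ≤ δ := by
    rw [hh, div_le_iff₀ hn1, ← div_le_iff₀' hδ]
    linarith
  have hnh : n * h = b - a := by rw [hh]; field_simp
  have hmem : ∀ k : ℕ, k ≤ n → a + k * h ∈ Icc a b := fun k hk => uniformPoint_mem hab hk
  have hstep : ∀ k : ℕ, a + k * h ≤ a + (k + 1 : ℕ) * h := fun k => by
    push_cast; linarith
  have hsub : ∀ k < n, Icc (a + k * h) (a + (k + 1 : ℕ) * h) ⊆ Icc a b := fun k hk =>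
    Icc_subset_Icc (hmem k hk.le).1 (hmem (k + 1) hk).2
  have hint : ∀ k < n, IntervalIntegrable f volume (a + k * h) (a + (k + 1 : ℕ) * h) :=
    fun k hk => (hf.mono ((uIcc_of_le (hstep k)).trans_subset (hsub k hk))).intervalIntegrable
  have hsum := intervalIntegral.sum_integral_adjacent_intervals
    (a := fun k : ℕ => a + k * h) hint
  simp only [Nat.cast_zero, zero_mul, add_zero, hnh, add_sub_cancel] at hsum
  rw [dist_comm, dist_eq_norm, ← hsum, ← Finset.sum_sub_distrib]
  have hterm : ∀ k ∈ Finset.range n,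
      ‖(∫ s in (a + k * h)..(a + (k + 1 : ℕ) * h), f s) - h • f (a + k * h)‖ ≤
        ε / (b - a + 1) * h := fun k hk => by
    have hk' := Finset.mem_range.1 hk
    have hlen : a + (k + 1 : ℕ) * h - (a + k * h) = h := by push_cast; ring
    have h1 : h • f (a + k * h) = ∫ _ in (a + k * h)..(a + (k + 1 : ℕ) * h), f (a + k * h) := by
      rw [intervalIntegral.integral_const, hlen]
    rw [h1, ← intervalIntegral.integral_sub (hint k hk') intervalIntegrable_const]
    refine (intervalIntegral.norm_integral_le_of_norm_le_const
      (C := ε / (b - a + 1)) fun s hs => ?_).trans_eq ?_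
    · rw [uIoc_of_le (hstep k)] at hs
      rw [← dist_eq_norm]
      refine huc s (hsub k hk' ⟨hs.1.le, hs.2⟩) _ (hmem k hk'.le) ?_
      rw [Real.dist_eq, abs_of_nonneg (by linarith [hs.1])]
      linarith [hs.2]
    · rw [hlen, abs_of_nonneg hh0]
  refine (norm_sum_le_of_le _ hterm).trans_lt ?_
  rw [Finset.sum_const, Finset.card_range, nsmul_eq_mul, mul_left_comm, hnh,
    div_mul_eq_mul_div, div_lt_iff₀ (by linarith)]
  nlinarith

variable {Ω : Type*} [MeasurableSpace Ω] {P : Measure Ω} {E : Type*} [NormedAddCommGroup E]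
  [NormedSpace ℝ E] [CompleteSpace E]

/-- The pathwise integral of a process with continuous paths is measurable although the process
is not assumed to be jointly measurable: it is a limit of Riemann sums. -/
theorem aestronglyMeasurable_integral_of_continuous_paths {Z : ℝ → Ω → E} {a b : ℝ} (hab : a ≤ b)
    (hm : ∀ s ∈ Icc a b, AEStronglyMeasurable (Z s) P)
    (hc : ∀ᵐ ω ∂P, ContinuousOn (fun s => Z s ω) (Icc a b)) :
    AEStronglyMeasurable (fun ω => ∫ s in a..b, Z s ω) P := by
  refine aestronglyMeasurable_of_tendsto_ae atTop (f := fun n : ℕ => fun ω =>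
    ∑ k ∈ Finset.range n, ((b - a) / n) • Z (a + k * ((b - a) / n)) ω) (fun n => ?_) ?_
  · refine Finset.aestronglyMeasurable_fun_sum _ fun k hk => (hm _ ?_).const_smul _
    exact uniformPoint_mem hab (Finset.mem_range.1 hk).le
  · filter_upwards [hc] with ω hω using tendsto_uniform_riemannSum hab hω

/-- Minkowski's integral inequality for a process with continuous paths, by Fatou's lemma along
Riemann sums. -/
theorem eLpNorm_integral_le_of_continuous_paths {Z : ℝ → Ω → E} {a b : ℝ} (hab : a ≤ b)
    {p : ℝ≥0∞} (hp : 1 ≤ p) (hm : ∀ s ∈ Icc a b, AEStronglyMeasurable (Z s) P)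
    (hc : ∀ᵐ ω ∂P, ContinuousOn (fun s => Z s ω) (Icc a b)) {B : ℝ≥0∞}
    (hB : ∀ s ∈ Icc a b, eLpNorm (Z s) p P ≤ B) :
    eLpNorm (fun ω => ∫ s in a..b, Z s ω) p P ≤ ENNReal.ofReal (b - a) * B := by
  have hmem : ∀ n, ∀ k ∈ Finset.range n, a + k * ((b - a) / n) ∈ Icc a b := fun n k hk =>
    uniformPoint_mem hab (Finset.mem_range.1 hk).le
  refine (Lp.eLpNorm_lim_le_liminf_eLpNorm (f := fun n : ℕ =>
    ∑ k ∈ Finset.range n, ((b - a) / n) • Z (a + k * ((b - a) / n))) (fun n => ?_) _ ?_).trans ?_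
  · exact Finset.aestronglyMeasurable_sum _ fun k hk => (hm _ (hmem n k hk)).const_smul _
  · filter_upwards [hc] with ω hω
    simpa only [Finset.sum_apply, Pi.smul_apply] using tendsto_uniform_riemannSum hab hω
  · refine liminf_le_of_le (h := fun c hc => ?_)
    obtain ⟨n, hn, hn0⟩ := (hc.and (eventually_gt_atTop 0)).exists
    refine hn.trans ((eLpNorm_sum_le (fun k hk => (hm _ (hmem n k hk)).const_smul _) hp).trans ?_)
    have hterm : ∀ k ∈ Finset.range n, eLpNorm (((b - a) / n) • Z (a + k * ((b - a) / n))) p P ≤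
        ENNReal.ofReal ((b - a) / n) * B := fun k hk => by
      rw [eLpNorm_const_smul, Real.enorm_eq_ofReal (div_nonneg (by linarith) (by positivity))]
      gcongr
      exact hB _ (hmem n k hk)
    refine (Finset.sum_le_sum hterm).trans_eq ?_
    have hn1 : (0 : ℝ) < n := by exact_mod_cast hn0
    rw [Finset.sum_const, Finset.card_range, nsmul_eq_mul, ← mul_assoc, ← ENNReal.ofReal_natCast,
      ← ENNReal.ofReal_mul hn1.le]
    congr 2
    field_simp

end PathIntegral

/-! ### Mean-square integrals against a white noise -/

section Noise

/-- A process on `[0,t]` with the first and second moments of the primitive of a white noise of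
intensity `κ`, that is, with covariance `κ min(s,u) I`, and with continuous paths. The noise
during the forward evolution alone has `κ = 1` and the folded noise has `κ = 2`. -/
structure IsNoisePrimitive {d : ℕ} {Ω : Type*} [MeasurableSpace Ω] (P : Measure Ω) (t κ : ℝ)
    (V : ℝ → Ω → PhaseSpace d) : Prop where
  intensity_nonneg : 0 ≤ κ
  memLp : ∀ s ∈ Icc 0 t, MemLp (V s) 2 P
  mean_eq_zero : ∀ s ∈ Icc 0 t, ∫ ω, V s ω ∂P = 0
  correlation : ∀ s ∈ Icc 0 t, ∀ u ∈ Icc 0 t, ∀ i j : Fin d,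
    ∫ ω, V s ω i * V u ω j ∂P = if i = j then κ * min s u else 0
  continuous_paths : ∀ᵐ ω ∂P, ContinuousOn (fun s => V s ω) (Icc 0 t)

variable {d : ℕ} {Ω : Type*} [MeasurableSpace Ω] {P : Measure Ω} {t κ : ℝ}
  {V : ℝ → Ω → PhaseSpace d}

theorem integral_sub_mul_sub {f₁ f₂ g₁ g₂ : Ω → ℝ} (hf₁ : MemLp f₁ 2 P) (hf₂ : MemLp f₂ 2 P)
    (hg₁ : MemLp g₁ 2 P) (hg₂ : MemLp g₂ 2 P) :
    ∫ ω, (f₁ ω - f₂ ω) * (g₁ ω - g₂ ω) ∂P =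
      ((∫ ω, f₁ ω * g₁ ω ∂P) - ∫ ω, f₁ ω * g₂ ω ∂P) -
        ((∫ ω, f₂ ω * g₁ ω ∂P) - ∫ ω, f₂ ω * g₂ ω ∂P) := by
  have h11 : Integrable (fun ω => f₁ ω * g₁ ω) P := hf₁.integrable_mul hg₁
  have h12 : Integrable (fun ω => f₁ ω * g₂ ω) P := hf₁.integrable_mul hg₂
  have h21 : Integrable (fun ω => f₂ ω * g₁ ω) P := hf₂.integrable_mul hg₁
  have h22 : Integrable (fun ω => f₂ ω * g₂ ω) P := hf₂.integrable_mul hg₂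
  have hd₁ : Integrable (fun ω => f₁ ω * g₁ ω - f₁ ω * g₂ ω) P := h11.sub h12
  have hd₂ : Integrable (fun ω => f₂ ω * g₁ ω - f₂ ω * g₂ ω) P := h21.sub h22
  rw [← integral_sub h11 h12, ← integral_sub h21 h22, ← integral_sub hd₁ hd₂]
  refine integral_congr_ae (ae_of_all _ fun ω => ?_)
  ring

theorem IsNoisePrimitive.integral_increment_mul (hV : IsNoisePrimitive P t κ V) {a b c e : ℝ}
    (ha : a ∈ Icc 0 t) (hb : b ∈ Icc 0 t) (hc : c ∈ Icc 0 t) (he : e ∈ Icc 0 t) (i j : Fin d) :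
    ∫ ω, (V b ω i - V a ω i) * (V e ω j - V c ω j) ∂P =
      if i = j then κ * ((min b e - min b c) - (min a e - min a c)) else 0 := by
  rw [integral_sub_mul_sub ((hV.memLp b hb).eval_piLp i) ((hV.memLp a ha).eval_piLp i)
    ((hV.memLp e he).eval_piLp j) ((hV.memLp c hc).eval_piLp j), hV.correlation b hb e he,
    hV.correlation b hb c hc, hV.correlation a ha e he, hV.correlation a ha c hc]
  split_ifs <;> ring

theorem IsNoisePrimitive.eLpNorm_sub (hV : IsNoisePrimitive P t κ V) {a b : ℝ}
    (ha : a ∈ Icc 0 t) (hb : b ∈ Icc 0 t) :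
    eLpNorm (V b - V a) 2 P = ENNReal.ofReal √(d * (κ * |b - a|)) := by
  have hm : MemLp (V b - V a) 2 P := (hV.memLp b hb).sub (hV.memLp a ha)
  rw [hm.eLpNorm_eq_integral_rpow_norm (by norm_num) (by norm_num), Real.sqrt_eq_rpow]
  have hsq : ∫ ω, ‖(V b - V a) ω‖ ^ (2 : ℝ≥0∞).toReal ∂P = d * (κ * |b - a|) := by
    have h1 : ∀ ω, ‖(V b - V a) ω‖ ^ (2 : ℝ≥0∞).toReal =
        ∑ i, (V b ω i - V a ω i) * (V b ω i - V a ω i) := fun ω => by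
      rw [ENNReal.toReal_ofNat, Real.rpow_ofNat, EuclideanSpace.real_norm_sq_eq]
      simp [sq]
    simp only [h1]
    have hmi : ∀ i, MemLp (fun ω => V b ω i - V a ω i) 2 P := fun i =>
      ((hV.memLp b hb).eval_piLp i).sub ((hV.memLp a ha).eval_piLp i)
    have hint : ∀ i, Integrable
        (fun ω => (V b ω i - V a ω i) * (V b ω i - V a ω i)) P := fun i =>
      (hmi i).integrable_mul (hmi i)
    rw [integral_finsetSum _ fun i _ => hint i]
    simp only [hV.integral_increment_mul ha hb ha hb, if_true]
    rw [Finset.sum_const, Finset.card_univ, Fintype.card_fin, nsmul_eq_mul]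
    congr 2
    rcases le_total a b with h | h
    · rw [abs_of_nonneg (by linarith), min_self, min_self, min_eq_left h, min_eq_right h]
      ring
    · rw [abs_of_nonpos (by linarith), min_self, min_self, min_eq_left h, min_eq_right h]
      ring
  rw [hsq]
  norm_num

theorem IsNoisePrimitive.zero_ae (hV : IsNoisePrimitive P t κ V) (ht : 0 ≤ t) :
    V 0 =ᵐ[P] 0 := by
  have h0 : (0 : ℝ) ∈ Icc 0 t := ⟨le_rfl, ht⟩
  have h1 : ∀ i, ∀ᵐ ω ∂P, V 0 ω i = 0 := fun i => by
    have h2 := hV.correlation 0 h0 0 h0 i i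
    rw [if_pos rfl, min_self, mul_zero] at h2
    have h3 := (hV.memLp 0 h0).eval_piLp i
    have h4 := (integral_eq_zero_iff_of_nonneg (fun ω => mul_self_nonneg (V 0 ω i))
      (h3.integrable_mul h3)).1 h2
    filter_upwards [h4] with ω hω using mul_self_eq_zero.1 hω
  filter_upwards [ae_all_iff.2 h1] with ω hω
  ext i
  exact hω i

/-- Integration by parts over one interval of a tagged partition. -/
theorem stieltjes_term_eq {E : Type*} [NormedAddCommGroup E] [NormedSpace ℝ E] [CompleteSpace E]
    {M D : ℝ → E →L[ℝ] E} (hD : Continuous D) (hMD : ∀ s, HasDerivAt M (D s) s)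
    {v : ℝ → E} {a c b : ℝ} (hac : a ≤ c) (hcb : c ≤ b) (hv : ContinuousOn v (Icc a b)) :
    M c (v b - v a) - (M b (v b) - M a (v a)) + ∫ s in a..b, D s (v s) =
      (∫ s in c..b, D s (v s - v b)) + ∫ s in a..c, D s (v s - v a) := by
  have hDv : ∀ p q, a ≤ p → p ≤ q → q ≤ b →
      IntervalIntegrable (fun s => D s (v s)) volume p q := fun p q hp hpq hq =>
    ((hD.continuousOn.clm_apply (hv.mono (Icc_subset_Icc hp hq))).mono
      (uIcc_of_le hpq).subset).intervalIntegrable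
  have hconst : ∀ (w : E) (p q : ℝ), ∫ s in p..q, D s w = M q w - M p w := fun w p q =>
    intervalIntegral.integral_eq_sub_of_hasDerivAt (f := fun s => M s w)
      (fun s _ => by simpa using (hMD s).clm_apply (hasDerivAt_const s w))
      ((hD.clm_apply continuous_const).intervalIntegrable _ _)
  have hDw : ∀ (w : E) (p q : ℝ), IntervalIntegrable (fun s => D s w) volume p q :=
    fun w p q => (hD.clm_apply continuous_const).intervalIntegrable _ _
  simp only [map_sub]
  rw [intervalIntegral.integral_sub (hDv c b hac hcb le_rfl) (hDw _ _ _),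
    intervalIntegral.integral_sub (hDv a c le_rfl hac hcb) (hDw _ _ _), hconst, hconst,
    ← intervalIntegral.integral_add_adjacent_intervals (hDv a c le_rfl hac hcb)
      (hDv c b hac hcb le_rfl)]
  abel

theorem partition_mono {s c : ℕ → ℝ} {n : ℕ} (h : ∀ k < n, s k ≤ c k ∧ c k ≤ s (k + 1)) {j k : ℕ}
    (hjk : j ≤ k) (hk : k ≤ n) : s j ≤ s k := by
  induction k, hjk using Nat.le_induction with
  | base => exact le_rfl
  | succ k _ ih => exact (ih (by omega)).trans ((h k hk).1.trans (h k hk).2)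

/-- For a continuously differentiable integrand `M`, the mean-square integral `∫₀ᵗ M dV` exists
and is given by the pathwise formula `M(t) V(t) - ∫₀ᵗ M' V ds`. By integration by parts on each
interval, the error of a Riemann-Stieltjes sum is the integral of `M'` against the increments of
`V` over parts of the intervals, and these are of the order of the square root of the mesh. -/
theorem IsNoisePrimitive.isMeanSquareIntegral (hV : IsNoisePrimitive P t κ V) (ht : 0 ≤ t)
    {M D : ℝ → PhaseSpace d →L[ℝ] PhaseSpace d} (hD : Continuous D)
    (hMD : ∀ s, HasDerivAt M (D s) s) {G : ℝ → Matrix (Fin d) (Fin d) ℝ}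
    (hG : ∀ s ∈ Icc 0 t, ∀ v, Matrix.toEuclideanLin (G s) v = M s v) {X : Ω → PhaseSpace d}
    (hX : ∀ᵐ ω ∂P, X ω = M t (V t ω) - ∫ s in (0 : ℝ)..t, D s (V s ω)) :
    IsMeanSquareIntegral P t G V X := by
  obtain ⟨C, hC⟩ := (isCompact_Icc (a := (0 : ℝ)) (b := t)).exists_bound_of_continuousOn
    hD.continuousOn
  have h0t : (0 : ℝ) ∈ Icc 0 t := ⟨le_rfl, ht⟩
  have htt : t ∈ Icc 0 t := ⟨ht, le_rfl⟩
  have hDm : ∀ s, ∀ f : Ω → PhaseSpace d, MemLp f 2 P → MemLp (fun ω => D s (f ω)) 2 P :=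
    fun s f hf => (D s).comp_memLp' hf
  have hDn : ∀ s ∈ Icc 0 t, ∀ f : Ω → PhaseSpace d,
      eLpNorm (fun ω => D s (f ω)) 2 P ≤ ENNReal.ofReal C * eLpNorm f 2 P := fun s hs f =>
    eLpNorm_le_mul_eLpNorm_of_ae_le_mul
      (ae_of_all _ fun ω => (D s).le_of_opNorm_le (hC s hs) _) _
  refine ⟨?_, fun δ hδ => ?_⟩
  · have hIm : MemLp (fun ω => ∫ s in (0 : ℝ)..t, D s (V s ω)) 2 P := by
      have hm : ∀ s ∈ Icc 0 t, AEStronglyMeasurable (fun ω => D s (V s ω)) P := fun s hs =>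
        (hDm s _ (hV.memLp s hs)).aestronglyMeasurable
      have hc : ∀ᵐ ω ∂P, ContinuousOn (fun s => D s (V s ω)) (Icc 0 t) := by
        filter_upwards [hV.continuous_paths] with ω hω using hD.continuousOn.clm_apply hω
      refine ⟨aestronglyMeasurable_integral_of_continuous_paths ht hm hc,
        (eLpNorm_integral_le_of_continuous_paths ht one_le_two hm hc
          (B := ENNReal.ofReal C * ENNReal.ofReal √(d * (κ * t))) fun s hs => ?_).trans_lt
          (by finiteness)⟩
      refine (hDn s hs _).trans ?_
      have h1 : V s =ᵐ[P] V s - V 0 := by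
        filter_upwards [hV.zero_ae ht] with ω hω
        rw [Pi.sub_apply, hω, Pi.zero_apply, sub_zero]
      rw [eLpNorm_congr_ae h1, hV.eLpNorm_sub h0t hs, sub_zero, abs_of_nonneg hs.1]
      have := hV.intensity_nonneg
      gcongr
      exact hs.2
    exact (((M t).comp_memLp' (hV.memLp t htt)).sub hIm).ae_eq (hX.mono fun ω h => h.symm)
  · have hlim :
        Tendsto (fun η : ℝ => ENNReal.ofReal (t * (C * √(d * (κ * η))))) (𝓝[>] 0) (𝓝 0) := by
      have h1 : Continuous fun η : ℝ => ENNReal.ofReal (t * (C * √(d * (κ * η)))) :=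
        ENNReal.continuous_ofReal.comp (by fun_prop)
      simpa using (h1.tendsto 0).mono_left nhdsWithin_le_nhds
    obtain ⟨η, hη, hη0⟩ := ((hlim.eventually (gt_mem_nhds hδ)).and self_mem_nhdsWithin).exists
    refine ⟨η, hη0, fun n s c hs0 hsn hsc => ?_⟩
    have hmono : ∀ {j k : ℕ}, j ≤ k → k ≤ n → s j ≤ s k := fun hjk hk =>
      partition_mono (fun k hk => ⟨(hsc k hk).1, (hsc k hk).2.1⟩) hjk hk
    have hmem : ∀ k ≤ n, s k ∈ Icc 0 t := fun k hk =>
      ⟨hs0 ▸ hmono k.zero_le hk, hsn ▸ hmono hk le_rfl⟩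
    -- the contribution of the part of an interval between its tag and one of its end points `e`
    have hpiece : ∀ p q e : ℝ, 0 ≤ p → p ≤ q → q ≤ t → e ∈ Icc 0 t →
        (∀ r ∈ Icc p q, |r - e| ≤ η) →
        AEStronglyMeasurable (fun ω => ∫ r in p..q, D r (V r ω - V e ω)) P ∧
        eLpNorm (fun ω => ∫ r in p..q, D r (V r ω - V e ω)) 2 P ≤
          ENNReal.ofReal (q - p) * ENNReal.ofReal (C * √(d * (κ * η))) := by
      intro p q e hp hpq hq he hη
      have hsub : Icc p q ⊆ Icc 0 t := Icc_subset_Icc hp hq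
      have hm : ∀ r ∈ Icc p q, AEStronglyMeasurable (fun ω => D r (V r ω - V e ω)) P :=
        fun r hr => (hDm r _ ((hV.memLp r (hsub hr)).sub (hV.memLp e he))).aestronglyMeasurable
      have hc : ∀ᵐ ω ∂P, ContinuousOn (fun r => D r (V r ω - V e ω)) (Icc p q) := by
        filter_upwards [hV.continuous_paths] with ω hω
        exact hD.continuousOn.clm_apply ((hω.mono hsub).sub continuousOn_const)
      refine ⟨aestronglyMeasurable_integral_of_continuous_paths hpq hm hc,
        eLpNorm_integral_le_of_continuous_paths hpq one_le_two hm hc fun r hr => ?_⟩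
      refine (hDn r (hsub hr) (V r - V e)).trans ?_
      rw [hV.eLpNorm_sub he (hsub hr),
        ENNReal.ofReal_mul ((norm_nonneg _).trans (hC 0 h0t))]
      have := hV.intensity_nonneg
      gcongr
      exact hη r hr
    set F : ℕ → Ω → PhaseSpace d := fun k ω =>
      (∫ r in c k..s (k + 1), D r (V r ω - V (s (k + 1)) ω)) +
        ∫ r in s k..c k, D r (V r ω - V (s k) ω) with hF
    have hFk : ∀ k ∈ Finset.range n, AEStronglyMeasurable (F k) P ∧ eLpNorm (F k) 2 P ≤
        ENNReal.ofReal (s (k + 1) - s k) * ENNReal.ofReal (C * √(d * (κ * η))) := by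
      intro k hk
      have hk := Finset.mem_range.1 hk
      obtain ⟨h1, h2, h3⟩ := hsc k hk
      have hk0 := hmem k hk.le
      have hk1 := hmem (k + 1) hk
      obtain ⟨m1, n1⟩ := hpiece (c k) (s (k + 1)) (s (k + 1)) (hk0.1.trans h1) h2 hk1.2 hk1
        fun r hr => abs_le.2 ⟨by linarith [hr.1], by linarith [hr.2, hη0.le]⟩
      obtain ⟨m2, n2⟩ := hpiece (s k) (c k) (s k) hk0.1 h1 (h2.trans hk1.2) hk0
        fun r hr => abs_le.2 ⟨by linarith [hr.1, hη0.le], by linarith [hr.2]⟩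
      refine ⟨m1.add m2, (eLpNorm_add_le m1 m2 one_le_two).trans ((add_le_add n1 n2).trans_eq ?_)⟩
      rw [← add_mul, ← ENNReal.ofReal_add (by linarith) (by linarith)]
      congr 2
      ring
    have hsum : (fun ω => (∑ k ∈ Finset.range n,
        Matrix.toEuclideanLin (G (c k)) (V (s (k + 1)) ω - V (s k) ω)) - X ω) =ᵐ[P]
          ∑ k ∈ Finset.range n, F k := by
      filter_upwards [hV.continuous_paths, hX, hV.zero_ae ht] with ω hω hXω h0
      have hterm : ∀ k ∈ Finset.range n, F k ω =
          M (c k) (V (s (k + 1)) ω - V (s k) ω) -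
            (M (s (k + 1)) (V (s (k + 1)) ω) - M (s k) (V (s k) ω)) +
            ∫ r in s k..s (k + 1), D r (V r ω) := fun k hk => by
        have hk := Finset.mem_range.1 hk
        exact (stieltjes_term_eq hD hMD (hsc k hk).1 (hsc k hk).2.1
          (hω.mono (Icc_subset_Icc (hmem k hk.le).1 (hmem (k + 1) hk).2))).symm
      have hDV : ∀ k < n,
          IntervalIntegrable (fun r => D r (V r ω)) volume (s k) (s (k + 1)) := fun k hk =>
        ((hD.continuousOn.clm_apply hω).mono ((uIcc_of_le (hmono k.le_succ hk)).trans_subset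
          (Icc_subset_Icc (hmem k hk.le).1 (hmem (k + 1) hk).2))).intervalIntegrable
      rw [Finset.sum_apply, Finset.sum_congr rfl hterm, Finset.sum_add_distrib,
        Finset.sum_sub_distrib, Finset.sum_range_sub (fun k => M (s k) (V (s k) ω)),
        intervalIntegral.sum_integral_adjacent_intervals hDV, hs0, hsn, h0, Pi.zero_apply,
        map_zero, sub_zero, hXω]
      have hGM : ∀ k ∈ Finset.range n,
          Matrix.toEuclideanLin (G (c k)) (V (s (k + 1)) ω - V (s k) ω) =
            M (c k) (V (s (k + 1)) ω - V (s k) ω) := fun k hk => by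
        have hk := Finset.mem_range.1 hk
        exact hG _ ⟨(hmem k hk.le).1.trans (hsc k hk).1,
          (hsc k hk).2.1.trans (hmem (k + 1) hk).2⟩ _
      rw [Finset.sum_congr rfl hGM]
      abel
    rw [eLpNorm_congr_ae hsum]
    refine (eLpNorm_sum_le (fun k hk => (hFk k hk).1) one_le_two).trans_lt ?_
    refine (Finset.sum_le_sum fun k hk => (hFk k hk).2).trans_lt ?_
    rw [← Finset.sum_mul, ← ENNReal.ofReal_sum_of_nonneg fun k hk => sub_nonneg.2
      (hmono k.le_succ (Finset.mem_range.1 hk)), Finset.sum_range_sub, hs0, hsn, sub_zero,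
      ← ENNReal.ofReal_mul ht]
    exact hη

end Noise

/-! ### Moments of mean-square integrals -/

section Moments

variable {Ω : Type*} [MeasurableSpace Ω] {P : Measure Ω}

theorem inner_toLp_eq_integral_mul {u v : Ω → ℝ} (hu : MemLp u 2 P) (hv : MemLp v 2 P) :
    inner ℝ (hu.toLp u) (hv.toLp v) = ∫ ω, u ω * v ω ∂P := by
  rw [L2.inner_def]
  refine integral_congr_ae ?_
  filter_upwards [hu.coeFn_toLp, hv.coeFn_toLp] with ω h1 h2
  rw [h1, h2, RCLike.inner_apply, conj_trivial, mul_comm]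

theorem tendsto_integral_mul_of_tendsto_eLpNorm {f g : ℕ → Ω → ℝ} {f₀ g₀ : Ω → ℝ}
    (hf : ∀ n, MemLp (f n) 2 P) (hg : ∀ n, MemLp (g n) 2 P) (hf₀ : MemLp f₀ 2 P)
    (hg₀ : MemLp g₀ 2 P) (hff : Tendsto (fun n => eLpNorm (f n - f₀) 2 P) atTop (𝓝 0))
    (hgg : Tendsto (fun n => eLpNorm (g n - g₀) 2 P) atTop (𝓝 0)) :
    Tendsto (fun n => ∫ ω, f n ω * g n ω ∂P) atTop (𝓝 (∫ ω, f₀ ω * g₀ ω ∂P)) := by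
  have h := ((Lp.tendsto_Lp_iff_tendsto_eLpNorm'' f hf f₀ hf₀).2 hff).inner
    ((Lp.tendsto_Lp_iff_tendsto_eLpNorm'' g hg g₀ hg₀).2 hgg) (𝕜 := ℝ)
  simpa only [inner_toLp_eq_integral_mul] using h

theorem integral_sum_mul_sum_of_orthogonal {ι : Type*} [DecidableEq ι] (s : Finset ι)
    {φ : ι → Ω → ℝ} (hφ : ∀ a ∈ s, MemLp (φ a) 2 P) {w : ι → ℝ}
    (horth : ∀ a ∈ s, ∀ b ∈ s, ∫ ω, φ a ω * φ b ω ∂P = if a = b then w a else 0) (g h : ι → ℝ) :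
    ∫ ω, (∑ a ∈ s, g a * φ a ω) * (∑ b ∈ s, h b * φ b ω) ∂P = ∑ a ∈ s, g a * h a * w a := by
  have hint : ∀ a ∈ s, ∀ b ∈ s, Integrable (fun ω => g a * h b * (φ a ω * φ b ω)) P :=
    fun a ha b hb => ((hφ a ha).integrable_mul (hφ b hb)).const_mul _
  have hexp : ∀ ω, (∑ a ∈ s, g a * φ a ω) * (∑ b ∈ s, h b * φ b ω) =
      ∑ a ∈ s, ∑ b ∈ s, g a * h b * (φ a ω * φ b ω) := fun ω => by
    rw [Finset.sum_mul_sum]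
    exact Finset.sum_congr rfl fun a _ => Finset.sum_congr rfl fun b _ => by ring
  simp only [hexp]
  rw [integral_finsetSum _ fun a ha => integrable_finsetSum _ fun b hb => hint a ha b hb]
  refine Finset.sum_congr rfl fun a ha => ?_
  rw [integral_finsetSum _ fun b hb => hint a ha b hb]
  have : ∀ b ∈ s, ∫ ω, g a * h b * (φ a ω * φ b ω) ∂P = if a = b then g a * h a * w a else 0 :=
    fun b hb => by
      rw [integral_const_mul, horth a ha b hb]
      split_ifs with hab
      · rw [hab]
      · rw [mul_zero]
  rw [Finset.sum_congr rfl this, Finset.sum_ite_eq, if_pos ha]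

variable {d : ℕ} {t κ : ℝ} {V : ℝ → Ω → PhaseSpace d}

/-- Increments over different intervals of the uniform partition are orthogonal. -/
theorem IsNoisePrimitive.integral_uniform_increments (hV : IsNoisePrimitive P t κ V) (ht : 0 ≤ t)
    {n k l : ℕ} (hk : k < n) (hl : l < n) (i j : Fin d) :
    ∫ ω, (V (0 + (k + 1 : ℕ) * ((t - 0) / n)) ω i - V (0 + k * ((t - 0) / n)) ω i) *
        (V (0 + (l + 1 : ℕ) * ((t - 0) / n)) ω j - V (0 + l * ((t - 0) / n)) ω j) ∂P =
      if (k, i) = (l, j) then κ * ((t - 0) / n) else 0 := by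
  rw [hV.integral_increment_mul (uniformPoint_mem ht hk.le) (uniformPoint_mem ht hk)
    (uniformPoint_mem ht hl.le) (uniformPoint_mem ht hl)]
  have hh : 0 ≤ (t - 0) / n := by rw [sub_zero]; positivity
  set h := (t - 0) / n
  have hmin : ∀ p q : ℕ, min (0 + p * h) (0 + q * h) = (min p q : ℕ) * h := fun p q => by
    rw [zero_add, zero_add, Nat.cast_min, min_mul_of_nonneg _ _ hh]
  simp only [hmin, Prod.mk.injEq]
  rcases lt_trichotomy k l with hkl | hkl | hkl
  · rw [min_eq_left (by omega), min_eq_left (by omega), min_eq_left (by omega),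
      min_eq_left (by omega), if_neg (show ¬(k = l ∧ i = j) by omega)]
    simp
  · subst hkl
    rw [min_self, min_self, min_eq_right (by omega), min_eq_left (by omega)]
    simp only [true_and]
    congr 1
    push_cast
    ring
  · rw [min_eq_right (by omega), min_eq_right (by omega), min_eq_right (by omega),
      min_eq_right (by omega), if_neg (show ¬(k = l ∧ i = j) by omega)]
    simp

/-- The Ito isometry `⟨X Xᵀ⟩ = κ ∫₀ᵗ G Gᵀ ds` for the mean-square integral `X = ∫₀ᵗ G dV`, and
`⟨X⟩ = 0`. Both follow for the Riemann-Stieltjes sums of the uniform partitions from the first and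
second moments of the increments and pass to the limit in `L²`. -/
theorem IsMeanSquareIntegral.moments [IsProbabilityMeasure P] (hV : IsNoisePrimitive P t κ V)
    (ht : 0 ≤ t) {G : ℝ → Matrix (Fin d) (Fin d) ℝ} (hG : ContinuousOn G (Icc 0 t))
    {X : Ω → PhaseSpace d} (hX : IsMeanSquareIntegral P t G V X) :
    ∫ ω, X ω ∂P = 0 ∧
      ∀ i j, meanOuter P X i j = κ * ∫ s in (0 : ℝ)..t, (G s * (G s).transpose) i j := by
  set pt : ℕ → ℕ → ℝ := fun n k => 0 + k * ((t - 0) / n) with hpt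
  have hmem : ∀ n k, k ≤ n → pt n k ∈ Icc 0 t := fun n k hk => uniformPoint_mem ht hk
  -- `φ n (k, p)` is the component `p` of the increment of `V` over the interval `k`
  set φ : ℕ → ℕ × Fin d → Ω → ℝ := fun n a ω =>
    V (pt n (a.1 + 1)) ω a.2 - V (pt n a.1) ω a.2 with hφ
  set Y : ℕ → Ω → PhaseSpace d := fun n ω => ∑ k ∈ Finset.range n,
    Matrix.toEuclideanLin (G (pt n k)) (V (pt n (k + 1)) ω - V (pt n k) ω) with hY
  set I : ℕ → Finset (ℕ × Fin d) := fun n => Finset.range n ×ˢ Finset.univ with hI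
  have hφm : ∀ n, ∀ a ∈ I n, MemLp (φ n a) 2 P := fun n a ha => by
    have hk : a.1 < n := Finset.mem_range.1 (Finset.mem_product.1 ha).1
    exact ((hV.memLp _ (hmem n _ hk)).eval_piLp a.2).sub
      ((hV.memLp _ (hmem n _ hk.le)).eval_piLp a.2)
  have hYi : ∀ n ω i, Y n ω i = ∑ a ∈ I n, G (pt n a.1) i a.2 * φ n a ω := fun n ω i => by
    rw [hY, hI, Finset.sum_product, WithLp.ofLp_sum, Finset.sum_apply]
    refine Finset.sum_congr rfl fun k _ => ?_
    rw [Matrix.toLpLin_apply]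
    rfl
  have hYm : ∀ n i, MemLp (fun ω => Y n ω i) 2 P := fun n i => by
    simp only [hYi]
    exact memLp_finsetSum _ fun a ha => (hφm n a ha).const_mul _
  have hXm : ∀ i, MemLp (fun ω => X ω i) 2 P := fun i => hX.1.eval_piLp i
  have hlim : ∀ i, Tendsto (fun n => eLpNorm ((fun ω => Y n ω i) - fun ω => X ω i) 2 P) atTop
      (𝓝 0) := fun i => by
    rw [ENNReal.tendsto_nhds_zero]
    intro δ hδ
    obtain ⟨η, hη, h⟩ := hX.2 δ hδ
    obtain ⟨n₀, hn₀⟩ := exists_nat_gt (t / η)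
    filter_upwards [eventually_gt_atTop n₀] with n hn
    have hn0 : (0 : ℝ) < n := by exact_mod_cast n₀.zero_le.trans_lt hn
    have hn1 : (n₀ : ℝ) < n := by exact_mod_cast hn
    have hstep : ∀ k, pt n (k + 1) - pt n k = t / n := fun k => by
      simp only [hpt]; push_cast; ring
    have hstep0 : 0 ≤ t / n := by positivity
    refine le_trans (eLpNorm_mono fun ω => ?_) (h n (pt n) (pt n) (by simp [hpt])
      (by simp only [hpt]; field_simp; ring) fun k _ => ⟨le_rfl, ?_, ?_⟩).le
    · exact PiLp.norm_apply_le (Y n ω - X ω) i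
    · linarith [hstep k]
    · rw [hstep, div_lt_iff₀ hn0, ← div_lt_iff₀' hη]
      linarith
  refine ⟨?_, fun i j => ?_⟩
  · ext i
    rw [eval_integral_piLp fun i => (hXm i).integrable one_le_two]
    have h1 := tendsto_integral_mul_of_tendsto_eLpNorm (fun n => hYm n i)
      (fun _ => memLp_const (1 : ℝ)) (hXm i) (memLp_const 1) (hlim i) (by simp)
    simp only [mul_one] at h1
    refine tendsto_nhds_unique h1 ?_
    have h0 : ∀ n, ∫ ω, Y n ω i ∂P = 0 := fun n => by
      simp only [hYi]
      rw [integral_finsetSum _ fun a ha =>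
        ((hφm n a ha).integrable one_le_two).const_mul _]
      refine Finset.sum_eq_zero fun a ha => ?_
      have hk : a.1 < n := Finset.mem_range.1 (Finset.mem_product.1 ha).1
      have hz : ∀ s ∈ Icc 0 t, ∫ ω, V s ω a.2 ∂P = 0 := fun s hs => by
        rw [← eval_integral_piLp fun i => ((hV.memLp s hs).eval_piLp i).integrable one_le_two,
          hV.mean_eq_zero s hs]
        rfl
      have hi : ∀ s ∈ Icc 0 t, Integrable (fun ω => V s ω a.2) P := fun s hs =>
        ((hV.memLp s hs).eval_piLp a.2).integrable one_le_two
      rw [integral_const_mul, integral_sub (hi _ (hmem n _ hk)) (hi _ (hmem n _ hk.le)),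
        hz _ (hmem n _ hk), hz _ (hmem n _ hk.le), sub_zero, mul_zero]
    simp [h0]
  · have h1 := tendsto_integral_mul_of_tendsto_eLpNorm (fun n => hYm n i) (fun n => hYm n j)
      (hXm i) (hXm j) (hlim i) (hlim j)
    refine tendsto_nhds_unique h1 ?_
    have h2 : ∀ n, ∫ ω, Y n ω i * Y n ω j ∂P = κ * ∑ k ∈ Finset.range n,
        ((t - 0) / n) • (G (pt n k) * (G (pt n k)).transpose) i j := fun n => by
      simp only [hYi]
      rw [integral_sum_mul_sum_of_orthogonal (I n) (hφm n) (w := fun _ => κ * ((t - 0) / n))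
        (fun a ha b hb => hV.integral_uniform_increments ht
          (Finset.mem_range.1 (Finset.mem_product.1 ha).1)
          (Finset.mem_range.1 (Finset.mem_product.1 hb).1) a.2 b.2)
        (fun a => G (pt n a.1) i a.2) (fun a => G (pt n a.1) j a.2), hI, Finset.sum_product,
        Finset.mul_sum]
      refine Finset.sum_congr rfl fun k _ => ?_
      rw [Matrix.mul_apply, smul_eq_mul, Finset.mul_sum, Finset.mul_sum]
      refine Finset.sum_congr rfl fun p _ => ?_
      rw [Matrix.transpose_apply]
      ring
    simp only [h2]
    have h3 : ContinuousOn (fun s => G s * (G s).transpose) (Icc 0 t) := by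
      rw [continuousOn_iff_continuous_domRestrict] at hG ⊢
      exact hG.matrix_mul hG.matrix_transpose
    have h4 : ContinuousOn (fun s => (G s * (G s).transpose) i j) (Icc 0 t) :=
      (continuous_id.matrix_elem i j).comp_continuousOn h3
    exact (tendsto_uniform_riemannSum ht h4).const_mul κ

end Moments

/-! ### The noises of the forward-backward evolution -/

section NoiseExamples

theorem foldedNoise_forwardNoise {d : ℕ} {Ω : Type*} {W : ℝ → Ω → PhaseSpace d} {s t : ℝ}
    (hs : s ∈ Icc 0 t) (ω : Ω) :
    foldedNoise t (forwardNoise t W) s ω = W s ω := by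
  have ht : 0 ≤ t := hs.1.trans hs.2
  simp only [foldedNoise, forwardNoise]
  rw [min_eq_left hs.2, min_eq_right (by linarith), min_eq_right (by linarith [hs.2]), sub_self,
    add_zero]

variable {d : ℕ} {Ω : Type*} [MeasurableSpace Ω] {P : Measure Ω} {t : ℝ}
  {W : ℝ → Ω → PhaseSpace d}

theorem IsIntegratedWhiteNoise.isNoisePrimitive (hW : IsIntegratedWhiteNoise W P) :
    IsNoisePrimitive P t 1 W where
  intensity_nonneg := zero_le_one
  memLp s hs := hW.memLp_two s hs.1
  mean_eq_zero s hs := hW.mean_eq_zero s hs.1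
  correlation s hs u hu i j := by rw [hW.correlation s u hs.1 hu.1, one_mul]
  continuous_paths := hW.continuous_paths.mono fun _ h => h.mono Icc_subset_Ici_self

/-- The noises `ξ(s)` and `ξ(2t-s)`, `0 ≤ s ≤ t`, are uncorrelated, so their sum has the
intensity `2`. -/
theorem IsIntegratedWhiteNoise.isNoisePrimitive_foldedNoise [IsFiniteMeasure P]
    (hW : IsIntegratedWhiteNoise W P) :
    IsNoisePrimitive P t 2 (foldedNoise t W) where
  intensity_nonneg := zero_le_two
  memLp s hs := (hW.memLp_two s hs.1).add
    ((hW.memLp_two (2 * t) (by linarith [hs.1, hs.2])).sub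
      (hW.memLp_two (2 * t - s) (by linarith [hs.1, hs.2])))
  mean_eq_zero s hs := by
    have h1 : 0 ≤ 2 * t := by linarith [hs.1, hs.2]
    have h2 : 0 ≤ 2 * t - s := by linarith [hs.1, hs.2]
    have hi : ∀ r, 0 ≤ r → Integrable (W r) P := fun r hr =>
      (hW.memLp_two r hr).integrable one_le_two
    have hd : Integrable (fun ω => W (2 * t) ω - W (2 * t - s) ω) P := (hi _ h1).sub (hi _ h2)
    simp only [foldedNoise]
    rw [integral_add (hi s hs.1) hd, integral_sub (hi _ h1) (hi _ h2), hW.mean_eq_zero s hs.1,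
      hW.mean_eq_zero _ h1, hW.mean_eq_zero _ h2, sub_zero, add_zero]
  correlation s hs u hu i j := by
    obtain ⟨hs0, hst⟩ := hs
    obtain ⟨hu0, hut⟩ := hu
    have h1 : 0 ≤ 2 * t := by linarith
    have h2 : 0 ≤ 2 * t - s := by linarith
    have h3 : 0 ≤ 2 * t - u := by linarith
    have hm : ∀ r, 0 ≤ r → ∀ i, MemLp (fun ω => W r ω i) 2 P := fun r hr i =>
      (hW.memLp_two r hr).eval_piLp i
    have hL := inner_toLp_eq_integral_mul
      ((hm s hs0 i).add ((hm _ h1 i).sub (hm _ h2 i)))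
      ((hm u hu0 j).add ((hm _ h1 j).sub (hm _ h3 j)))
    refine hL.symm.trans ?_
    rw [MemLp.toLp_add (hm s hs0 i) ((hm _ h1 i).sub (hm _ h2 i)),
      MemLp.toLp_add (hm u hu0 j) ((hm _ h1 j).sub (hm _ h3 j)),
      MemLp.toLp_sub (hm _ h1 i) (hm _ h2 i), MemLp.toLp_sub (hm _ h1 j) (hm _ h3 j)]
    simp only [inner_add_left, inner_sub_left, inner_add_right, inner_sub_right,
      inner_toLp_eq_integral_mul]
    rw [hW.correlation _ _ hs0 hu0, hW.correlation _ _ hs0 h1, hW.correlation _ _ hs0 h3,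
      hW.correlation _ _ h1 hu0, hW.correlation _ _ h1 h1, hW.correlation _ _ h1 h3,
      hW.correlation _ _ h2 hu0, hW.correlation _ _ h2 h1, hW.correlation _ _ h2 h3,
      min_self, min_eq_left (show s ≤ 2 * t by linarith),
      min_eq_left (show s ≤ 2 * t - u by linarith), min_eq_right (show u ≤ 2 * t by linarith),
      min_eq_right (show 2 * t - u ≤ 2 * t by linarith),
      min_eq_right (show u ≤ 2 * t - s by linarith),
      min_eq_left (show 2 * t - s ≤ 2 * t by linarith)]
    split_ifs
    · rcases le_total s u with h | h
      · rw [min_eq_left h, min_eq_right (by linarith)]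
        ring
      · rw [min_eq_right h, min_eq_left (by linarith)]
        ring
    · ring
  continuous_paths := by
    filter_upwards [hW.continuous_paths] with ω hω
    have h1 : ContinuousOn (fun s => W (2 * t - s) ω) (Icc 0 t) :=
      hω.comp (f := fun s => 2 * t - s) (by fun_prop) fun s hs => by
        change 0 ≤ 2 * t - s
        linarith [hs.1, hs.2]
    exact (hω.mono Icc_subset_Ici_self).add (continuousOn_const.sub h1)

end NoiseExamples

/-! ### The linear response -/

section Response

variable {d : ℕ} {Ω : Type*} [MeasurableSpace Ω] {P : Measure Ω}
  {Φ : ℝ → PhaseSpace d → PhaseSpace d} {t : ℝ} {x : PhaseSpace d}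
  {S : ℝ → PhaseSpace d → PhaseSpace d} {N Ξ : ℝ → Ω → PhaseSpace d}
  {R : C(Icc (0 : ℝ) (2 * t), PhaseSpace d) →L[ℝ] C(Icc (0 : ℝ) (2 * t), PhaseSpace d)}

/-- A process is obtained, path by path, from the forcing `N` by the operator `R`. -/
def IsPathwiseImage (P : Measure Ω) (N Ξ : ℝ → Ω → PhaseSpace d)
    (R : C(Icc (0 : ℝ) (2 * t), PhaseSpace d) →L[ℝ] C(Icc (0 : ℝ) (2 * t), PhaseSpace d)) : Prop :=
  ∀ᵐ ω ∂P, ∃ n : C(Icc (0 : ℝ) (2 * t), PhaseSpace d), (∀ τ, n τ = N τ ω) ∧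
    ∀ τ : Icc (0 : ℝ) (2 * t), Ξ τ ω = R n τ

theorem exists_isPathwiseImage
    (hN : ∀ᵐ ω ∂P, ContinuousOn (fun τ => N τ ω) (Icc 0 (2 * t))) :
    ∃ Ξ, IsPathwiseImage P N Ξ R := by
  classical
  refine ⟨fun τ ω => if h : ContinuousOn (fun τ => N τ ω) (Icc 0 (2 * t)) ∧ τ ∈ Icc 0 (2 * t) then
    R (exists_path h.1).choose ⟨τ, h.2⟩ else 0, ?_⟩
  filter_upwards [hN] with ω hω
  refine ⟨(exists_path hω).choose, (exists_path hω).choose_spec, fun τ => ?_⟩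
  rw [dif_pos ⟨hω, τ.2⟩]

/-- The solvability for small amplitudes and the choice of a solution family make the condition on
all families in `IsLinearResponse` non-vacuous, so that the limit determines the process. -/
theorem isLinearResponse_iff_isPathwiseImage
    (hR : ∀ (N : ℝ → PhaseSpace d) (n : C(Icc (0 : ℝ) (2 * t), PhaseSpace d)), (∀ τ, n τ = N τ) →
        (∀ᶠ ε in 𝓝 (0 : ℝ), ∃ y, IsBFSolution Φ t x N ε y) ∧
        ∀ y : ℝ → ℝ → PhaseSpace d, (∀ᶠ ε in 𝓝 (0 : ℝ), IsBFSolution Φ t x N ε (y ε)) →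
          ∀ τ : Icc (0 : ℝ) (2 * t),
            Tendsto (fun ε : ℝ => ε⁻¹ • (y ε τ - y 0 τ)) (𝓝[≠] 0) (𝓝 (R n τ)))
    (hN : ∀ᵐ ω ∂P, ContinuousOn (fun τ => N τ ω) (Icc 0 (2 * t))) :
    IsLinearResponse P Φ t x N Ξ ↔ IsPathwiseImage P N Ξ R := by
  classical
  constructor
  · intro h
    filter_upwards [h, hN] with ω hω hNω
    obtain ⟨n, hn⟩ := exists_path hNω
    obtain ⟨hex, hlim⟩ := hR (fun τ => N τ ω) n hn
    refine ⟨n, hn, fun τ => ?_⟩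
    have hy : ∀ᶠ ε in 𝓝 (0 : ℝ), IsBFSolution Φ t x (fun τ => N τ ω) ε
        (if h : ∃ y, IsBFSolution Φ t x (fun τ => N τ ω) ε y then h.choose else 0) := by
      filter_upwards [hex] with ε hε
      rw [dif_pos hε]
      exact hε.choose_spec
    exact tendsto_nhds_unique (hω.2 _ hy τ τ.2) (hlim _ hy τ)
  · intro h
    filter_upwards [h] with ω ⟨n, hn, hΞ⟩
    obtain ⟨hex, hlim⟩ := hR (fun τ => N τ ω) n hn
    refine ⟨hex, fun y hy τ hτ => ?_⟩
    rw [hΞ ⟨τ, hτ⟩]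
    exact hlim y hy ⟨τ, hτ⟩

theorem solvesLinearEquation_iff_isPathwiseImage (hΦ : IsC1Field Φ t) (h2t : 0 ≤ 2 * t)
    {u : C(Icc (0 : ℝ) (2 * t), PhaseSpace d)} (hu : ∀ τ, u τ = S (min τ (2 * t - τ)) x)
    (hR : ∀ g v, v = R g ↔ v = weightedPrimitive (isWeight_reversalSign t) h2t
        (pathApply (jacobianAlong hΦ.reversal u) v) + g)
    (hN : ∀ᵐ ω ∂P, ContinuousOn (fun τ => N τ ω) (Icc 0 (2 * t))) :
    SolvesLinearEquation P Φ t x S N Ξ ↔ IsPathwiseImage P N Ξ R := by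
  constructor
  · intro h
    filter_upwards [h, hN] with ω hω hNω
    obtain ⟨n, hn⟩ := exists_path hNω
    obtain ⟨v, hv, hvR⟩ := (linearEquation_iff (Ξ := fun τ => Ξ τ ω) hΦ h2t hn hu).1 hω
    refine ⟨n, hn, fun τ => ?_⟩
    rw [← hv, ← (hR n v).2 hvR]
  · intro h
    filter_upwards [h] with ω ⟨n, hn, hΞ⟩
    exact (linearEquation_iff (Ξ := fun τ => Ξ τ ω) hΦ h2t hn hu).2
      ⟨R n, fun τ => (hΞ τ).symm, (hR n _).1 rfl⟩

/-- The matrix of a linear map in the standard basis. -/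
def standardMatrix (L : PhaseSpace d →L[ℝ] PhaseSpace d) : Matrix (Fin d) (Fin d) ℝ :=
  Matrix.of fun i j => L (EuclideanSpace.single j 1) i

theorem toEuclideanLin_standardMatrix (L : PhaseSpace d →L[ℝ] PhaseSpace d) (v : PhaseSpace d) :
    Matrix.toEuclideanLin (standardMatrix L) v = L v := by
  have hv : v = ∑ j, v j • EuclideanSpace.single j (1 : ℝ) := by
    simpa using ((EuclideanSpace.basisFun (Fin d) ℝ).sum_repr v).symm
  ext i
  conv_rhs => rw [hv, map_sum, WithLp.ofLp_sum, Finset.sum_apply]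
  rw [Matrix.toLpLin_apply]
  change ∑ j, standardMatrix L i j * v j = _
  refine Finset.sum_congr rfl fun j _ => ?_
  rw [map_smul, mul_comm]
  rfl

theorem standardMatrix_mul_of_leftInverse {L L' : PhaseSpace d →L[ℝ] PhaseSpace d}
    (h : ∀ v, L' (L v) = v) : standardMatrix L' * standardMatrix L = 1 := by
  apply (Matrix.toEuclideanLin (𝕜 := ℝ) (m := Fin d) (n := Fin d)).injective
  ext1 v
  rw [Matrix.toLpLin_mul_same, LinearMap.comp_apply, Matrix.toLpLin_one, LinearMap.id_apply]
  change Matrix.toEuclideanLin _ (Matrix.toEuclideanLin _ v) = v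
  rw [toEuclideanLin_standardMatrix, toEuclideanLin_standardMatrix, h]

theorem continuousOn_standardMatrix {L : ℝ → PhaseSpace d →L[ℝ] PhaseSpace d} {s : Set ℝ}
    (h : ∀ v, ContinuousOn (fun r => L r v) s) :
    ContinuousOn (fun r => standardMatrix (L r)) s :=
  continuousOn_pi.2 fun i => continuousOn_pi.2 fun j =>
    (EuclideanSpace.proj (𝕜 := ℝ) i).continuous.comp_continuousOn (h (EuclideanSpace.single j 1))

end Response

end

theorem mainTheorem3 {d : ℕ} {Ω : Type*} [MeasurableSpace Ω] (P : Measure Ω)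
    [IsProbabilityMeasure P]
    (Φ : ℝ → PhaseSpace d → PhaseSpace d) (t : ℝ) (ht : 0 < t) (hΦ : IsC1Field Φ t)
    (x : PhaseSpace d) (S : ℝ → PhaseSpace d → PhaseSpace d) (hS : IsForwardFlow Φ t x S)
    (W : ℝ → Ω → PhaseSpace d) (hW : IsIntegratedWhiteNoise W P) :
    -- the tangent map exists, is invertible and depends continuously on time
    ((∀ s ∈ Icc 0 t, DifferentiableAt ℝ (S s) x ∧ IsUnit (tangentMatrix S x s)) ∧
      ContinuousOn (tangentMatrix S x) (Icc 0 t)) ∧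
    -- noise during the forward and the backward evolution
    ((∃ Ξ, IsLinearResponse P Φ t x W Ξ) ∧
      (∀ Ξ, IsLinearResponse P Φ t x W Ξ ↔ SolvesLinearEquation P Φ t x S W Ξ) ∧
      ∀ Ξ, IsLinearResponse P Φ t x W Ξ →
        IsMeanSquareIntegral P t (fun s => (tangentMatrix S x s)⁻¹) (foldedNoise t W) (Ξ (2 * t)) ∧
        ∫ ω, Ξ (2 * t) ω ∂P = 0 ∧
        (1 / 2 : ℝ) • meanOuter P (Ξ (2 * t)) = sigmaBF S x t) ∧
    -- noise during the forward evolution only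
    ((∃ Ξ, IsLinearResponse P Φ t x (forwardNoise t W) Ξ) ∧
      (∀ Ξ, IsLinearResponse P Φ t x (forwardNoise t W) Ξ ↔
        SolvesLinearEquation P Φ t x S (forwardNoise t W) Ξ) ∧
      ∀ Ξ, IsLinearResponse P Φ t x (forwardNoise t W) Ξ →
        IsMeanSquareIntegral P t (fun s => (tangentMatrix S x s)⁻¹) W (Ξ (2 * t)) ∧
        ∫ ω, Ξ (2 * t) ω ∂P = 0 ∧
        meanOuter P (Ξ (2 * t)) = sigmaBF S x t) := by
  have h2t : 0 ≤ 2 * t := by linarith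
  obtain ⟨u, R, hu, hlin, hresp, hflow⟩ := exists_responseOperator hΦ h2t hS
  obtain ⟨M, D, hD, hMD, hML, hformula⟩ := exists_response_formula ht hΦ h2t hu hlin
  -- the tangent map and its inverse
  have hfderiv : ∀ (s : ℝ) (hs : s ∈ Icc 0 t) (v : PhaseSpace d),
      fderiv ℝ (S s) x v = R (.const _ v) ⟨s, hs.1, by linarith [hs.2]⟩ := fun s hs v => by
    rw [(hflow s hs).fderiv]
    rfl
  have hinv : ∀ s ∈ Icc 0 t, standardMatrix (M s) * tangentMatrix S x s = 1 := fun s hs =>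
    standardMatrix_mul_of_leftInverse fun v => by
      rw [hfderiv s hs]
      exact hML ⟨s, hs.1, by linarith [hs.2]⟩ hs.2 v
  have hG : ∀ s ∈ Icc 0 t, (tangentMatrix S x s)⁻¹ = standardMatrix (M s) := fun s hs =>
    Matrix.inv_eq_left_inv (hinv s hs)
  have hGM : ∀ s ∈ Icc 0 t, ∀ v, Matrix.toEuclideanLin (tangentMatrix S x s)⁻¹ v = M s v :=
    fun s hs v => by rw [hG s hs, toEuclideanLin_standardMatrix]
  have hGc : ContinuousOn (fun s => (tangentMatrix S x s)⁻¹) (Icc 0 t) :=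
    (continuousOn_standardMatrix (L := M) fun v =>
      ((continuous_iff_continuousAt.2 fun s => (hMD s).continuousAt).clm_apply
        continuous_const).continuousOn).congr hG
  have hTc : ContinuousOn (tangentMatrix S x) (Icc 0 t) :=
    continuousOn_standardMatrix fun v => by
      refine ((R (.const _ v)).continuous.Icc_extend' (h := h2t)).continuousOn.congr fun s hs => ?_
      rw [hfderiv s hs, IccExtend_of_mem h2t _ ⟨hs.1, by linarith [hs.2]⟩]
  have hsigma : ∀ i j, ∫ s in (0 : ℝ)..t,
      ((tangentMatrix S x s)⁻¹ * ((tangentMatrix S x s)⁻¹).transpose) i j = sigmaBF S x t i j :=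
    fun i j => by
      simp only [sigmaBF, Matrix.of_apply, Matrix.mul_inv_rev, Matrix.transpose_nonsing_inv]
  -- the conclusions on the linear response to a noise `N` whose folded noise is `V`
  have main : ∀ (N V : ℝ → Ω → PhaseSpace d) (κ : ℝ), IsNoisePrimitive P t κ V →
      (∀ s ∈ Icc 0 t, ∀ ω, foldedNoise t N s ω = V s ω) →
      (∀ᵐ ω ∂P, ContinuousOn (fun τ => N τ ω) (Icc 0 (2 * t))) →
      (∃ Ξ, IsLinearResponse P Φ t x N Ξ) ∧
      (∀ Ξ, IsLinearResponse P Φ t x N Ξ ↔ SolvesLinearEquation P Φ t x S N Ξ) ∧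
      ∀ Ξ, IsLinearResponse P Φ t x N Ξ →
        IsMeanSquareIntegral P t (fun s => (tangentMatrix S x s)⁻¹) V (Ξ (2 * t)) ∧
        ∫ ω, Ξ (2 * t) ω ∂P = 0 ∧
        meanOuter P (Ξ (2 * t)) = κ • sigmaBF S x t := by
    intro N V κ hV hNV hN
    have hiff := fun Ξ => isLinearResponse_iff_isPathwiseImage (Ξ := Ξ) hresp hN
    refine ⟨?_, fun Ξ => ?_, fun Ξ hΞ => ?_⟩
    · obtain ⟨Ξ, hΞ⟩ := exists_isPathwiseImage (R := R) hN
      exact ⟨Ξ, (hiff Ξ).2 hΞ⟩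
    · rw [hiff, solvesLinearEquation_iff_isPathwiseImage hΦ h2t hu hlin hN]
    · have hX : ∀ᵐ ω ∂P, Ξ (2 * t) ω = M t (V t ω) - ∫ s in (0 : ℝ)..t, D s (V s ω) := by
        filter_upwards [(hiff Ξ).1 hΞ] with ω ⟨n, hn, hnΞ⟩
        refine (hnΞ ⟨2 * t, h2t, le_rfl⟩).trans ((hformula (fun τ => N τ ω) n hn).trans ?_)
        congr 1
        · rw [← hNV t ⟨ht.le, le_rfl⟩]
          rfl
        · refine intervalIntegral.integral_congr fun s hs => ?_
          rw [uIcc_of_le ht.le] at hs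
          rw [← hNV s hs]
          rfl
      have hms := hV.isMeanSquareIntegral ht.le hD hMD hGM hX
      obtain ⟨hmean, hcov⟩ := hms.moments hV ht.le hGc
      refine ⟨hms, hmean, ?_⟩
      ext i j
      rw [hcov, hsigma, Matrix.smul_apply, smul_eq_mul]
  refine ⟨⟨fun s hs => ⟨(hflow s hs).differentiableAt,
    IsUnit.of_mul_eq_one_right _ (hinv s hs)⟩, hTc⟩, ?_, ?_⟩
  · obtain ⟨h1, h2, h3⟩ := main W (foldedNoise t W) 2 hW.isNoisePrimitive_foldedNoise
      (fun _ _ _ => rfl) (hW.continuous_paths.mono fun _ h => h.mono Icc_subset_Ici_self)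
    refine ⟨h1, h2, fun Ξ hΞ => ?_⟩
    obtain ⟨h4, h5, h6⟩ := h3 Ξ hΞ
    refine ⟨h4, h5, ?_⟩
    rw [h6, smul_smul]
    norm_num
  · obtain ⟨h1, h2, h3⟩ := main (forwardNoise t W) W 1 hW.isNoisePrimitive
      (fun s hs ω => foldedNoise_forwardNoise hs ω) (by
        filter_upwards [hW.continuous_paths] with ω hω
        exact hω.comp (f := fun τ => min τ t) (by fun_prop) fun τ hτ => le_min hτ.1 ht.le)
    refine ⟨h1, h2, fun Ξ hΞ => ?_⟩
    obtain ⟨h4, h5, h6⟩ := h3 Ξ hΞ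
    exact ⟨h4, h5, by rw [h6, one_smul]⟩
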